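/- Let $\mathbb{R}^d$ have an orthonormal basis that is divided into $m$ blocks $U_j=\{u_{j1},\dots,u_{jr_j}\}$, $j=1,\dots,m$, with $\sum_{j=1}^m r_j=d$. Let $0\le d_{0j}\le r_j$ and $c_{\infty j}\ge 0$ be real numbers, let $c_{2j}=\sqrt{d_{0j}}\,c_{\infty j}$, let $q_1,q_2\in[0,1]$, let $\alpha\ge 2$ be an integer, let $\epsilon(\alpha)\in\mathbb{R}$, and let $\mathcal F:\mathcal X\to\mathbb{R}^d$ be any function on the set $\mathcal X$ of possible datapoints. Hybrid clipping of $v\in\mathbb{R}^d$: for each $j$, the projection $p_j$ of $v$ to $\mathrm{span}(U_j)$ is replaced by $p_j\min\{1,c_{2j}/\|p_j\|_2\}$, and then each coordinate $t$ of the result with respect to $U_j$ is replaced by $t\min\{1,c_{\infty j}/|t|\}$ (zero vectors and zero coordinates stay zero). For $\sigma=(\sigma_1,\dots,\sigma_m)$ with all $\sigma_j>0$, the $(q_1,q_2)$-twice sampling mechanism $\mathcal M_\sigma$ on a finite dataset $X$ (a finite collection of datapoints, repetitions allowed) is the following. Each datapoint of $X$ is kept independently with probability $q_1$. Then, independently for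 each basis vector $u_{jl}$, each kept datapoint is selected independently with probability $q_2$, the $u_{jl}$-coordinates of the hybrid clippings of $\mathcal F(x)$ are summed over the selected datapoints $x$, and independent noise $\mathcal N(0,\sigma_j^2)$ is added, giving $o_{jl}$ (so the noise in the $j$-th subspace is isotropic, $\mathcal N(0,\sigma_j^2 I_{r_j})$). The output is $\sum_{j,l}o_{jl}u_{jl}$. A mechanism $\mathcal M$ is $(\alpha,\epsilon)$-RDP if $\mathsf D_\alpha(\mathbb P_{\mathcal M(X)}\|\mathbb P_{\mathcal M(X')})\le\epsilon$ for all $X,X'$ one of which is obtained from the other by adding one datapoint, where $\mathsf D_\alpha(P\|Q)=\frac1{\alpha-1}\log\int\left(\frac{dP}{dQ}\right)^\alpha dQ$ (and $+\infty$ if $P\not\ll Q$). For $v=2,3,\dots$ let $$\epsilon_0(v)=\sum_{j=1}^m\frac{d_{0j}}{v-1}\log\Big((1-q_2)^v+\sum_{l=1}^v\binom vl(1-q_2)^{v-l}q_2^l\,e^{\frac{l(l-1)c_{\infty j}^2}{2\sigma_j^2}}\Big),$$ and consider the problem of minimizing $\sum_{j=1}^m r_j\sigma_j^2$ over all $\sigma\in(0,\infty)^m$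 subject to $$\frac{1}{\alpha-1}\log\Big((1-q_1)^\alpha+\sum_{v=1}^\alpha\binom\alpha v(1-q_1)^{\alpha-v}q_1^v\,e^{(v-1)\epsilon_0(v)}\Big)\le\epsilon(\alpha),\qquad(*)$$ where $(v-1)\epsilon_0(v)$ is read as $0$ for $v=1$. Then: 1. For every $\sigma\in(0,\infty)^m$ that satisfies $(*)$, the mechanism $\mathcal M_\sigma$ is $(\alpha,\epsilon(\alpha))$-RDP. 2. In particular, for every solution $\sigma$ of the minimization problem (the optimized noise parameter), $\mathcal M_\sigma$ is $(\alpha,\epsilon(\alpha))$-RDP. 3. If $q_1,q_2,\epsilon(\alpha)>0$ and $d_{0j},c_{\infty j}>0$ for all $j$, then the minimization problem has a solution. -/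

import Mathlib

open scoped ENNReal

noncomputable section

namespace HybridTwice

/-! ### Rényi differential privacy -/

/-- The Rényi divergence of order `α` (for `α > 1`),
`1 / (α - 1) * log ∫ (dP/dQ) ^ α dQ`, with the value `⊤` if `P` is not absolutely continuous
with respect to `Q`. -/
def renyiDiv {Ω : Type*} [MeasurableSpace Ω] (α : ℝ) (P Q : MeasureTheory.Measure Ω) : EReal :=
  open Classical in
  if P.AbsolutelyContinuous Q then ((α - 1)⁻¹ : ℝ) * ENNReal.log (∫⁻ o, (P.rnDeriv Q o) ^ α ∂Q) else ⊤

/-- Datasets are finite collections of datapoints, repetitions allowed. Two datasets are adjacent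
if one of them is the other one with one additional datapoint. -/
def Adjacent {𝒳 : Type*} (X X' : Multiset 𝒳) : Prop :=
  (∃ x, X' = x ::ₘ X) ∨ (∃ x, X = x ::ₘ X')

/-- `(α, ε)`-Rényi differential privacy of a randomized algorithm, which is given by the law
`M X` of its output on each dataset `X`. -/
def IsRDP {𝒳 Ω : Type*} [MeasurableSpace Ω] (M : Multiset 𝒳 → MeasureTheory.Measure Ω)
    (α ε : ℝ) : Prop :=
  ∀ X X' : Multiset 𝒳, Adjacent X X' → renyiDiv α (M X) (M X') ≤ (ε : EReal)

/-! ### Hybrid clipping -/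

/-- Norm clipping `v ↦ v * min {1, c / ‖v‖}`. On `ℝ` this clips the absolute value. -/
def clip {V : Type*} [NormedAddCommGroup V] [NormedSpace ℝ V] (c : ℝ) (v : V) : V :=
  min 1 (c / ‖v‖) • v

variable {d m : ℕ} {r : Fin m → ℕ}

/-- The orthogonal projection of `v` to the `j`-th subspace, the span of the `j`-th block
`b ⟨j, 1⟩, …, b ⟨j, r j⟩` of the orthonormal basis. -/
def blockProj (b : OrthonormalBasis (Σ j : Fin m, Fin (r j)) ℝ (EuclideanSpace ℝ (Fin d)))
    (j : Fin m) (v : EuclideanSpace ℝ (Fin d)) : EuclideanSpace ℝ (Fin d) :=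
  ∑ l : Fin (r j), b.repr v ⟨j, l⟩ • b ⟨j, l⟩

/-- Hybrid clipping of `v`, in coordinates with respect to the basis `b`: the projection to the
`j`-th subspace is clipped in `l₂`-norm with parameter `c₂ j`, then each of its coordinates is
clipped in absolute value with parameter `cInf j`. -/
def hybridClip (b : OrthonormalBasis (Σ j : Fin m, Fin (r j)) ℝ (EuclideanSpace ℝ (Fin d)))
    (c₂ cInf : Fin m → ℝ) (v : EuclideanSpace ℝ (Fin d)) : (Σ j : Fin m, Fin (r j)) → ℝ :=
  fun i => clip (cInf i.1) (b.repr (clip (c₂ i.1) (blockProj b i.1 v)) i)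

/-! ### Sampling -/

/-- The law of the output of `κ` on a Poisson sample of `X` with rate `q`: each element of `X` is
kept independently with probability `q`, so that each of the `2 ^ |X|` sub-collections `S`
(`Multiset.powerset` lists them with multiplicity) is drawn with probability
`q ^ |S| * (1 - q) ^ (|X| - |S|)`. -/
def poissonSample {𝒳 Ω : Type*} [MeasurableSpace Ω] (q : ℝ)
    (κ : Multiset 𝒳 → MeasureTheory.Measure Ω) (X : Multiset 𝒳) : MeasureTheory.Measure Ω :=
  (X.powerset.map fun S =>
    ENNReal.ofReal (q ^ S.card * (1 - q) ^ (X.card - S.card)) • κ S).sum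

/-- Private aggregation with coordinate-wise Poisson sampling of rate `q₂`: independently for each
coordinate `i`, a Poisson sample `T` is drawn, the `i`-th coordinates `y x i` of its members are
added up, and Gaussian noise of standard deviation `s i` is added. -/
def coordSampling {𝒳 ι : Type*} [Fintype ι] (q₂ : ℝ) (y : 𝒳 → ι → ℝ) (s : ι → ℝ)
    (S : Multiset 𝒳) : MeasureTheory.Measure (ι → ℝ) :=
  MeasureTheory.Measure.pi fun i =>
    poissonSample q₂ (fun T =>
      ProbabilityTheory.gaussianReal (T.map fun x => y x i).sum (Real.toNNReal (s i ^ 2))) S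

/-- The law of the output of `(q₁, q₂)`-twice sampling with hybrid clipping on the dataset `X`:
draw a Poisson sample of rate `q₁`, run on it the coordinate-wise sampled private aggregation of
the clipped values `F x` in coordinates with respect to the basis `b`, with independent noise
`N(0, σ j ^ 2)` on each coordinate in block `j` (so that the noise in the `j`-th subspace is
`N(0, σ j ^ 2 I)`), and return the vector which has these coordinates. -/
def hybridTwiceSampling {𝒳 : Type*} (F : 𝒳 → EuclideanSpace ℝ (Fin d))
    (b : OrthonormalBasis (Σ j : Fin m, Fin (r j)) ℝ (EuclideanSpace ℝ (Fin d)))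
    (c₂ cInf : Fin m → ℝ) (q₁ q₂ : ℝ) (σ : Fin m → ℝ) (X : Multiset 𝒳) :
    MeasureTheory.Measure (EuclideanSpace ℝ (Fin d)) :=
  (poissonSample q₁
    (coordSampling q₂ (fun x => hybridClip b c₂ cInf (F x)) (fun i => σ i.1)) X).map
    (fun o => ∑ i, o i • b i)

/-! ### The noise optimization problem -/

/-- The bound `ε₀(v)`, for `v ≥ 2`, of coordinate-wise sampling with hybrid clipping. (At `v = 1`
it only enters through the product `(v - 1) * ε₀(v) = 0`.) -/
def epsZero (d₀ cInf : Fin m → ℝ) (q₂ : ℝ) (σ : Fin m → ℝ) (v : ℕ) : ℝ :=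
  ∑ j, d₀ j / ((v : ℝ) - 1) *
    Real.log ((1 - q₂) ^ v + ∑ l ∈ Finset.Icc 1 v,
      (v.choose l : ℝ) * (1 - q₂) ^ (v - l) * q₂ ^ l *
        Real.exp ((l : ℝ) * ((l : ℝ) - 1) * cInf j ^ 2 / (2 * σ j ^ 2)))

/-- The bound of twice sampling in terms of the bounds `ε₀(v)` of coordinate-wise sampling. -/
def twiceBound (q₁ : ℝ) (ε₀ : ℕ → ℝ) (α : ℕ) : ℝ :=
  Real.log ((1 - q₁) ^ α + ∑ v ∈ Finset.Icc 1 α,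
    (α.choose v : ℝ) * (1 - q₁) ^ (α - v) * q₁ ^ v *
      Real.exp (((v : ℝ) - 1) * ε₀ v)) / ((α : ℝ) - 1)

/-- The noise parameters `σ = (σ 1, …, σ m)` with positive entries that satisfy the privacy
constraint. -/
def feasible (d₀ cInf : Fin m → ℝ) (q₁ q₂ : ℝ) (α : ℕ) (ε : ℝ) : Set (Fin m → ℝ) :=
  {σ | (∀ j, 0 < σ j) ∧ twiceBound q₁ (epsZero d₀ cInf q₂ σ) α ≤ ε}

/-- `σ` is an optimized noise parameter, an element of
`arg min ∑ j, r j * σ j ^ 2` over the feasible noise parameters. -/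
def IsOptimalNoise (r : Fin m → ℕ) (d₀ cInf : Fin m → ℝ) (q₁ q₂ : ℝ) (α : ℕ) (ε : ℝ)
    (σ : Fin m → ℝ) : Prop :=
  σ ∈ feasible d₀ cInf q₁ q₂ α ε ∧
    IsMinOn (fun τ : Fin m → ℝ => ∑ j, (r j : ℝ) * τ j ^ 2) (feasible d₀ cInf q₁ q₂ α ε) σ

end HybridTwice

end

namespace HybridTwice

open MeasureTheory ProbabilityTheory
open scoped NNReal

/-! ### A pointwise inequality for reversed mixtures -/

/-! Fix the datapoint `x` in which the two datasets differ. Given the sample `S` of the others, the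
output law is `κ S` without `x` and the mixture `(1 - q) κ S + q κ (x ::ₘ S)` with it. So everything
reduces to controlling moments of the likelihood ratio, in both directions, under three operations:
averaging over `S` (joint convexity, `MomentBound.add`), products over coordinates
(`MomentBound.pi`) and mixing a measure into its partner (`MomentBound.mix`). The starting pair is
two shifted Gaussians, and mixing is applied twice: per coordinate with `q₂`, then globally with
`q₁`.

Mixing is the hard step. With `w = dP/dQ` and `p = 1 - q`, the forward moment `∫ (p + q w) ^ v dQ`
is a binomial sum, but the reversed one is `∫ (p + q w) ^ (1 - v) dQ`. It is dominated pointwise by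
a convex combination of `(p + q w) ^ v` and `w (p + q / w) ^ v`, up to a multiple of `w - 1`, which
integrates to zero. Both dominating functions have the same binomial bound.

Clipping then enters through Jensen: the moment bound of a coordinate `y i` is at most that of a
coordinate of size `c`, raised to the power `y i ^ 2 / c ^ 2`. These exponents add up to at most
`d₀` in a block.

An optimum exists because the constraint keeps every `σ j` away from zero and the cost keeps it
bounded, so the problem lives on a compact set. -/

theorem mul_log_le_log_mix {p q w : ℝ} (hp : 0 ≤ p) (hq : 0 ≤ q) (hpq : p + q = 1) (hw : 0 < w) :
    q * Real.log w ≤ Real.log (p + q * w) := by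
  have h := Real.geom_mean_le_arith_mean2_weighted hp hq zero_le_one hw.le hpq
  rw [Real.one_rpow, one_mul, mul_one] at h
  rw [← Real.log_rpow hw]
  exact Real.log_le_log (Real.rpow_pos_of_pos hw _) h

theorem mix_pos {p q w : ℝ} (hp : 0 ≤ p) (hq : 0 ≤ q) (hpq : p + q = 1) (hw : 0 < w) :
    0 < p + q * w := by
  rcases hp.eq_or_lt with rfl | hp
  · have : q = 1 := by linarith
    simpa [this] using hw
  · positivity

/-- This is the sign of a second derivative in `exists_reverse_mix_le`. Convexity of `exp` turns the
right side into one exponential, and `log (p + q w) ≥ q log w`, `log (p + q / w) ≥ -q log w` leave a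
multiple of `log w`. As `log w` has either sign, its coefficient must vanish, which is the condition
`h` on `l`. -/
theorem inv_pow_mix_le {p q w l l' : ℝ} (n : ℕ) (hp : 0 ≤ p) (hq : 0 ≤ q) (hpq : p + q = 1)
    (hw : 0 < w) (hl : 0 ≤ l) (hl' : 0 ≤ l') (hll : l + l' = 1)
    (h : l * (2 * n * q + 3) = 3 * p) :
    (p + q * w)⁻¹ ^ (n + 3) ≤ l * (p + q * w) ^ n + l' * ((p + q * w⁻¹) ^ n * w⁻¹ ^ 3) := by
  have ha := mix_pos hp hq hpq hw
  have hs := mix_pos hp hq hpq (inv_pos.2 hw)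
  have h1 := mul_log_le_log_mix hp hq hpq hw
  have h2 := mul_log_le_log_mix hp hq hpq (inv_pos.2 hw)
  rw [Real.log_inv] at h2
  set a := p + q * w
  set s := p + q * w⁻¹
  have e1 : a ^ n = Real.exp (n * Real.log a) := by
    rw [← Real.log_pow, Real.exp_log (by positivity)]
  have e2 : s ^ n * w⁻¹ ^ 3 = Real.exp (n * Real.log s + (3 : ℕ) * Real.log w⁻¹) := by
    rw [← Real.log_pow, ← Real.log_pow, Real.exp_add, Real.exp_log (by positivity),
      Real.exp_log (by positivity)]
  have e3 : a⁻¹ ^ (n + 3) = Real.exp ((n + 3 : ℕ) * Real.log a⁻¹) := by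
    rw [← Real.log_pow, Real.exp_log (by positivity)]
  rw [e1, e2, e3]
  have hc := convexOn_exp.2 (Set.mem_univ (n * Real.log a))
    (Set.mem_univ (n * Real.log s + (3 : ℕ) * Real.log w⁻¹)) hl hl' hll
  refine le_trans (Real.exp_le_exp.2 ?_) hc
  simp only [smul_eq_mul, Real.log_inv]
  push_cast
  have hn : (0 : ℝ) ≤ n := n.cast_nonneg
  have k1 := mul_le_mul_of_nonneg_left h1 (show 0 ≤ l * n + (n + 3) by positivity)
  have k2 := mul_le_mul_of_nonneg_left h2 (show 0 ≤ l' * n by positivity)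
  have k3 : (l * n + (n + 3)) * q - l' * n * q - 3 * l' = 0 := by
    have : l' = 1 - l := by linarith
    subst this
    have : p = 1 - q := by linarith
    subst this
    linarith
  have k4 : ((l * n + (n + 3)) * q - l' * n * q - 3 * l') * Real.log w = 0 := by rw [k3, zero_mul]
  linarith

/-- The convex combination of two forward moments dominates the reversed moment
up to a multiple of `w - 1`. -/
theorem exists_reverse_mix_le {p q : ℝ} (n : ℕ) (hp : 0 ≤ p) (hq : 0 ≤ q) (hpq : p + q = 1) :
    ∃ l l' c : ℝ, 0 ≤ l ∧ 0 ≤ l' ∧ l + l' = 1 ∧ ∀ w : ℝ, 0 < w →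
      (p + q * w)⁻¹ ^ (n + 1) + c * (w - 1) ≤
        l * (p + q * w) ^ (n + 2) + l' * (w * (p + q * w⁻¹) ^ (n + 2)) := by
  have hd : 0 < 2 * n * q + 3 := by positivity
  obtain ⟨l, hl⟩ : ∃ l, l = 3 * p / (2 * n * q + 3) := ⟨_, rfl⟩
  have hl0 : 0 ≤ l := by rw [hl]; positivity
  have hl1 : l ≤ 1 := by
    rw [hl, div_le_one hd]
    have : 0 ≤ n * q := by positivity
    linarith
  have hl2 : l * (2 * n * q + 3) = 3 * p := by rw [hl]; field_simp
  have hl' : 0 ≤ 1 - l := by linarith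
  -- `G` is right side minus left side; it vanishes at `1`. Once `G` is convex, its tangent at `1`
  -- lies below it, so `c` is the slope `G' 1`.
  obtain ⟨G, hG⟩ : ∃ G : ℝ → ℝ, G = fun w => l * (p + q * w) ^ (n + 2) +
    (1 - l) * (w * (p + q * w⁻¹) ^ (n + 2)) - (p + q * w)⁻¹ ^ (n + 1) := ⟨_, rfl⟩
  obtain ⟨G', hG'⟩ : ∃ G : ℝ → ℝ, G = fun w => l * ((n + 2) * q * (p + q * w) ^ (n + 1)) +
    (1 - l) * ((p + q * w⁻¹) ^ (n + 2) - (n + 2) * q * ((p + q * w⁻¹) ^ (n + 1) * w⁻¹)) +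
    (n + 1) * q * (p + q * w)⁻¹ ^ (n + 2) := ⟨_, rfl⟩
  have da : ∀ w : ℝ, HasDerivAt (fun w => p + q * w) q w := fun w => by
    simpa using ((hasDerivAt_id w).const_mul q).const_add p
  have dai : ∀ w : ℝ, 0 < w → HasDerivAt (fun w => (p + q * w)⁻¹) (-q * (p + q * w)⁻¹ ^ 2) w :=
    fun w hw => by
      have := (da w).inv (mix_pos hp hq hpq hw).ne'
      rwa [div_eq_mul_inv, ← inv_pow] at this
  have ds : ∀ w : ℝ, 0 < w → HasDerivAt (fun w => p + q * w⁻¹) (-q * w⁻¹ ^ 2) w := fun w hw => by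
    have := ((hasDerivAt_inv hw.ne').const_mul q).const_add p
    exact this.congr_deriv (by rw [inv_pow]; ring)
  have dG : ∀ w : ℝ, 0 < w → HasDerivAt G (G' w) w := fun w hw => by
    have := ((((da w).pow (n + 2)).const_mul l).add
      (((hasDerivAt_id w).mul ((ds w hw).pow (n + 2))).const_mul (1 - l))).sub
      ((dai w hw).pow (n + 1))
    rw [hG, hG']
    refine this.congr_deriv ?_
    have hww : w * w⁻¹ ^ 2 = w⁻¹ := by field_simp
    simp only [Nat.add_sub_cancel, id, Pi.pow_apply, show n + 2 - 1 = n + 1 from rfl]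
    push_cast
    generalize p + q * w⁻¹ = s
    generalize (p + q * w)⁻¹ = a
    linear_combination -(1 - l) * (n + 2) * s ^ (n + 1) * q * hww
  have dG' : ∀ w : ℝ, 0 < w → HasDerivAt G' ((n + 1) * (n + 2) * q ^ 2 * (l * (p + q * w) ^ n +
      (1 - l) * ((p + q * w⁻¹) ^ n * w⁻¹ ^ 3) - (p + q * w)⁻¹ ^ (n + 3))) w := fun w hw => by
    have := ((((da w).pow (n + 1)).const_mul ((n + 2) * q)).const_mul l).add
      ((((ds w hw).pow (n + 2)).sub
        ((((ds w hw).pow (n + 1)).mul (hasDerivAt_inv hw.ne')).const_mul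
          ((n + 2) * q))).const_mul (1 - l)) |>.add
      (((dai w hw).pow (n + 2)).const_mul ((n + 1) * q))
    rw [hG']
    refine this.congr_deriv ?_
    simp only [Nat.add_sub_cancel, show n + 2 - 1 = n + 1 from rfl, Pi.pow_apply]
    push_cast
    rw [← inv_pow]
    generalize p + q * w⁻¹ = s
    generalize (p + q * w)⁻¹ = a
    ring
  have hconv : ConvexOn ℝ (Set.Ioi 0) G := by
    refine convexOn_of_hasDerivWithinAt2_nonneg (f' := G') (convex_Ioi 0)
      (fun w hw => (dG w hw).continuousAt.continuousWithinAt)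
      (fun w hw => (dG w (by simpa using hw)).hasDerivWithinAt)
      (fun w hw => (dG' w (by simpa using hw)).hasDerivWithinAt) (fun w hw => ?_)
    have := inv_pow_mix_le n hp hq hpq (by simpa using hw) hl0 hl' (by ring) hl2
    exact mul_nonneg (by positivity) (by linarith)
  have hG1 : G 1 = 0 := by simp [hG, hpq]
  refine ⟨l, 1 - l, G' 1, hl0, hl', by ring, fun w hw => ?_⟩
  have key : G' 1 * (w - 1) ≤ G w := by
    rcases lt_trichotomy w 1 with h | rfl | h
    · have := hconv.slope_le_of_hasDerivAt (Set.mem_Ioi.2 hw) (Set.mem_Ioi.2 one_pos) h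
        (dG 1 one_pos)
      rw [slope_def_field, hG1, div_le_iff₀ (by linarith)] at this
      linarith
    · simp [hG1]
    · have := hconv.le_slope_of_hasDerivAt (Set.mem_Ioi.2 one_pos) (Set.mem_Ioi.2 hw) h
        (dG 1 one_pos)
      rw [slope_def_field, hG1, le_div_iff₀ (by linarith)] at this
      linarith
  rw [hG] at key
  linarith

/-- A form of `exists_reverse_mix_le` without subtraction. -/
theorem exists_nnreal_reverse_mix_le {p q : ℝ≥0} (n : ℕ) (hpq : p + q = 1) :
    ∃ l l' c c' : ℝ≥0, l + l' = 1 ∧ ∀ w : ℝ≥0, w ≠ 0 →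
      (p + q * w)⁻¹ ^ (n + 1) + c * w + c' ≤
        l * (p + q * w) ^ (n + 2) + l' * (w * (p + q * w⁻¹) ^ (n + 2)) + c' * w + c := by
  obtain ⟨l, l', c, hl, hl', hll, h⟩ :=
    exists_reverse_mix_le n p.coe_nonneg q.coe_nonneg (by exact_mod_cast hpq)
  lift l to ℝ≥0 using hl
  lift l' to ℝ≥0 using hl'
  -- The slope may be negative: its positive and negative parts go to opposite sides.
  refine ⟨l, l', c.toNNReal, (-c).toNNReal, by exact_mod_cast hll, fun w hw => ?_⟩
  have := h w (by positivity)
  have hc : c = max c 0 - max (-c) 0 := by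
    rcases le_total c 0 with h | h <;> simp [h]
  rw [← NNReal.coe_le_coe]
  push_cast
  rw [Real.coe_toNNReal', Real.coe_toNNReal']
  rw [hc, sub_mul] at this
  linarith

/-! ### Pairs of measures with bounded moments of the likelihood ratio -/

/-- `P` has a positive density `ρ` with respect to `Q` such that `h v` bounds both
`∫ (dP/dQ) ^ v dQ` and `∫ (dQ/dP) ^ v dP` for all `v`. -/
def MomentBound {Ω : Type*} [MeasurableSpace Ω] (P Q : Measure Ω) (h : ℕ → ℝ≥0) : Prop :=
  ∃ ρ : Ω → ℝ≥0, Measurable ρ ∧ (∀ x, ρ x ≠ 0) ∧ P = Q.withDensity (fun x => (ρ x : ℝ≥0∞)) ∧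
    ∀ v : ℕ, ∫⁻ x, (ρ x ^ v : ℝ≥0) ∂Q ≤ h v ∧ ∫⁻ x, (ρ x * (ρ x)⁻¹ ^ v : ℝ≥0) ∂Q ≤ h v

namespace MomentBound

variable {Ω : Type*} [MeasurableSpace Ω] {P Q P₁ Q₁ P₂ Q₂ : Measure Ω} {h h₁ h₂ : ℕ → ℝ≥0}

theorem mono (H : MomentBound P Q h₁) (hh : ∀ v, h₁ v ≤ h₂ v) : MomentBound P Q h₂ := by
  obtain ⟨ρ, hm, h0, hP, hv⟩ := H
  exact ⟨ρ, hm, h0, hP, fun v => ⟨(hv v).1.trans (by exact_mod_cast hh v),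
    (hv v).2.trans (by exact_mod_cast hh v)⟩⟩

/-- The density becomes `ρ⁻¹` and the two families of moments trade places. This treats adding and
removing a datapoint at once. -/
theorem symm (H : MomentBound P Q h) : MomentBound Q P h := by
  obtain ⟨ρ, hm, h0, rfl, hv⟩ := H
  refine ⟨fun x => (ρ x)⁻¹, hm.inv, fun x => inv_ne_zero (h0 x), ?_, fun v => ?_⟩
  · have hm' : Measurable fun x => (((ρ x)⁻¹ : ℝ≥0) : ℝ≥0∞) := hm.inv.coe_nnreal_ennreal
    rw [← withDensity_mul _ hm.coe_nnreal_ennreal hm']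
    have : ((fun x => (ρ x : ℝ≥0∞)) * fun x => (((ρ x)⁻¹ : ℝ≥0) : ℝ≥0∞)) = 1 := by
      ext x
      simp only [Pi.mul_apply, Pi.one_apply, ← ENNReal.coe_mul]
      rw [mul_inv_cancel₀ (h0 x), ENNReal.coe_one]
    rw [this, withDensity_one]
  · have hm' := hm.inv
    rw [lintegral_withDensity_eq_lintegral_mul _ hm.coe_nnreal_ennreal (by fun_prop),
      lintegral_withDensity_eq_lintegral_mul _ hm.coe_nnreal_ennreal (by fun_prop)]
    simp only [Pi.mul_apply, ← ENNReal.coe_mul, inv_inv]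
    refine ⟨(hv v).2, ?_⟩
    simp_rw [mul_inv_cancel_left₀ (h0 _)]
    exact (hv v).1

theorem smul (c : ℝ≥0) (H : MomentBound P Q h) :
    MomentBound ((c : ℝ≥0∞) • P) ((c : ℝ≥0∞) • Q) (fun v => c * h v) := by
  obtain ⟨ρ, hm, h0, rfl, hv⟩ := H
  refine ⟨ρ, hm, h0, by rw [withDensity_smul_measure], fun v => ?_⟩
  rw [lintegral_smul_measure, lintegral_smul_measure]
  push_cast
  exact ⟨mul_le_mul_right (hv v).1 _, mul_le_mul_right (hv v).2 _⟩

theorem exists_density_sum (Q₁ Q₂ : Measure Ω) [IsFiniteMeasure Q₁] [IsFiniteMeasure Q₂] :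
    ∃ η₁ η₂ : Ω → ℝ≥0, Measurable η₁ ∧ Measurable η₂ ∧ (∀ x, η₁ x + η₂ x = 1) ∧
      Q₁ = (Q₁ + Q₂).withDensity (fun x => (η₁ x : ℝ≥0∞)) ∧
      Q₂ = (Q₁ + Q₂).withDensity (fun x => (η₂ x : ℝ≥0∞)) := by
  set Q := Q₁ + Q₂ with hQ
  have hle : Q₁ ≤ Q := Measure.le_add_right le_rfl
  have hae := Measure.rnDeriv_le_one_of_le hle
  -- The derivative is at most `1` only almost everywhere; truncation makes the two densities sum to
  -- `1` at every point.
  set η : Ω → ℝ≥0 := fun x => min 1 (Q₁.rnDeriv Q x).toNNReal with hη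
  have hm : Measurable η := measurable_const.min (Q₁.measurable_rnDeriv Q).ennreal_toNNReal
  have hη1 : ∀ x, η x ≤ 1 := fun x => min_le_left _ _
  have h1 : Q₁ = Q.withDensity (fun x => (η x : ℝ≥0∞)) := by
    conv_lhs => rw [← Measure.withDensity_rnDeriv_eq Q₁ Q hle.absolutelyContinuous]
    refine withDensity_congr_ae ?_
    filter_upwards [hae] with x hx
    have hx' : Q₁.rnDeriv Q x ≤ 1 := hx
    have hne : Q₁.rnDeriv Q x ≠ ∞ := (hx'.trans_lt ENNReal.one_lt_top).ne
    rw [hη]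
    simp only
    rw [min_eq_right, ENNReal.coe_toNNReal hne]
    rw [← ENNReal.coe_le_coe, ENNReal.coe_toNNReal hne]
    exact hx'
  refine ⟨η, fun x => 1 - η x, hm, measurable_const.sub hm,
    fun x => add_tsub_cancel_of_le (hη1 x), h1, ?_⟩
  have h2 : Q₁ + Q.withDensity (fun x => ((1 - η x : ℝ≥0) : ℝ≥0∞)) = Q₁ + Q₂ := by
    conv_lhs => rw [h1, ← withDensity_add_left hm.coe_nnreal_ennreal]
    have : ((fun x => (η x : ℝ≥0∞)) + fun x => ((1 - η x : ℝ≥0) : ℝ≥0∞)) = 1 := by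
      ext x
      simp only [Pi.add_apply, Pi.one_apply, ← ENNReal.coe_add]
      rw [add_tsub_cancel_of_le (hη1 x), ENNReal.coe_one]
    rw [this, withDensity_one]
  exact ((Measure.add_right_inj _ _ _).1 h2).symm

theorem zpow_mix_le (n : ℤ) {a b x y : ℝ≥0} (hab : a + b = 1) (hx : x ≠ 0) (hy : y ≠ 0) :
    (a * x + b * y) ^ n ≤ a * x ^ n + b * y ^ n := by
  have := (convexOn_zpow (𝕜 := ℝ) n).2 (Set.mem_Ioi.2 (show (0 : ℝ) < x by positivity))
    (Set.mem_Ioi.2 (show (0 : ℝ) < y by positivity)) a.coe_nonneg b.coe_nonneg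
    (by exact_mod_cast hab)
  rw [← NNReal.coe_le_coe]
  push_cast
  exact this

theorem mul_inv_pow_eq_zpow {x : ℝ≥0} (hx : x ≠ 0) (v : ℕ) : x * x⁻¹ ^ v = x ^ (1 - v : ℤ) := by
  rw [zpow_sub₀ hx, zpow_one, zpow_natCast, inv_pow, div_eq_mul_inv]

/-- Relative to `Q₁ + Q₂`, the likelihood ratio of the sums is the average of `ρ₁` and `ρ₂` with
weights `η₁`, `η₂`. Both moments are integrals of `ρ ^ n` for an integer `n`, namely `v` and `1 -
v`, and integer powers are convex on the positive reals. -/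
theorem add [IsFiniteMeasure Q₁] [IsFiniteMeasure Q₂]
    (H₁ : MomentBound P₁ Q₁ h₁) (H₂ : MomentBound P₂ Q₂ h₂) :
    MomentBound (P₁ + P₂) (Q₁ + Q₂) (fun v => h₁ v + h₂ v) := by
  obtain ⟨ρ₁, hm₁, h0₁, hP₁, hv₁⟩ := H₁
  obtain ⟨ρ₂, hm₂, h0₂, hP₂, hv₂⟩ := H₂
  obtain ⟨η₁, η₂, mη₁, mη₂, hη, hQ₁, hQ₂⟩ := exists_density_sum Q₁ Q₂
  have int₁ : ∀ f : Ω → ℝ≥0, Measurable f →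
      ∫⁻ x, (f x : ℝ≥0∞) ∂Q₁ = ∫⁻ x, (η₁ x * f x : ℝ≥0) ∂(Q₁ + Q₂) := fun f hf => by
    conv_lhs => rw [hQ₁]
    rw [lintegral_withDensity_eq_lintegral_mul _ mη₁.coe_nnreal_ennreal hf.coe_nnreal_ennreal]
    simp
  have int₂ : ∀ f : Ω → ℝ≥0, Measurable f →
      ∫⁻ x, (f x : ℝ≥0∞) ∂Q₂ = ∫⁻ x, (η₂ x * f x : ℝ≥0) ∂(Q₁ + Q₂) := fun f hf => by
    conv_lhs => rw [hQ₂]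
    rw [lintegral_withDensity_eq_lintegral_mul _ mη₂.coe_nnreal_ennreal hf.coe_nnreal_ennreal]
    simp
  have hpos : ∀ x, η₁ x * ρ₁ x + η₂ x * ρ₂ x ≠ 0 := fun x h => by
    rw [add_eq_zero, mul_eq_zero, mul_eq_zero, or_iff_left (h0₁ x), or_iff_left (h0₂ x)] at h
    have := hη x
    rw [h.1, h.2] at this
    simp at this
  have key : ∀ n : ℤ, ∫⁻ x, ((η₁ x * ρ₁ x + η₂ x * ρ₂ x) ^ n : ℝ≥0) ∂(Q₁ + Q₂) ≤
      ∫⁻ x, (ρ₁ x ^ n : ℝ≥0) ∂Q₁ + ∫⁻ x, (ρ₂ x ^ n : ℝ≥0) ∂Q₂ := fun n => by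
    have hm : Measurable fun x => ((η₁ x * ρ₁ x ^ n : ℝ≥0) : ℝ≥0∞) :=
      (mη₁.mul (hm₁.pow_const n)).coe_nnreal_ennreal
    rw [int₁ _ (hm₁.pow_const n), int₂ _ (hm₂.pow_const n), ← lintegral_add_left hm]
    refine lintegral_mono fun x => ?_
    rw [← ENNReal.coe_add]
    exact ENNReal.coe_le_coe.2 (zpow_mix_le n (hη x) (h0₁ x) (h0₂ x))
  refine ⟨fun x => η₁ x * ρ₁ x + η₂ x * ρ₂ x, by fun_prop, hpos, ?_, fun v => ?_⟩
  · have e₁ : P₁ = (Q₁ + Q₂).withDensity (fun x => ((η₁ x * ρ₁ x : ℝ≥0) : ℝ≥0∞)) := by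
      conv_lhs => rw [hP₁, hQ₁]
      rw [← withDensity_mul _ mη₁.coe_nnreal_ennreal hm₁.coe_nnreal_ennreal]
      simp [Pi.mul_def]
    have e₂ : P₂ = (Q₁ + Q₂).withDensity (fun x => ((η₂ x * ρ₂ x : ℝ≥0) : ℝ≥0∞)) := by
      conv_lhs => rw [hP₂, hQ₂]
      rw [← withDensity_mul _ mη₂.coe_nnreal_ennreal hm₂.coe_nnreal_ennreal]
      simp [Pi.mul_def]
    have hm : Measurable fun x => ((η₁ x * ρ₁ x : ℝ≥0) : ℝ≥0∞) :=
      (mη₁.mul hm₁).coe_nnreal_ennreal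
    conv_lhs => rw [e₁, e₂]
    rw [← withDensity_add_left hm]
    simp [Pi.add_def]
  · have k1 := key v
    have k2 := key (1 - v)
    simp only [← mul_inv_pow_eq_zpow (hpos _), ← mul_inv_pow_eq_zpow (h0₁ _),
      ← mul_inv_pow_eq_zpow (h0₂ _), zpow_natCast] at k1 k2
    push_cast [-ENNReal.coe_pow, -ENNReal.coe_mul]
    exact ⟨k1.trans (add_le_add (hv₁ v).1 (hv₂ v).1), k2.trans (add_le_add (hv₁ v).2 (hv₂ v).2)⟩

theorem map {Ω' : Type*} [MeasurableSpace Ω'] (e : Ω ≃ᵐ Ω') (H : MomentBound P Q h) :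
    MomentBound (P.map e) (Q.map e) h := by
  obtain ⟨ρ, hm, h0, rfl, hv⟩ := H
  have hm' : Measurable fun y => ρ (e.symm y) := hm.comp e.symm.measurable
  refine ⟨fun y => ρ (e.symm y), hm', fun y => h0 _, ?_, fun v => ?_⟩
  · ext s hs
    rw [withDensity_apply _ hs, e.map_apply, withDensity_apply _ (e.measurable hs),
      e.restrict_map, lintegral_map_equiv]
    simp
  · rw [lintegral_map_equiv, lintegral_map_equiv]
    simpa using hv v

theorem prod_lintegral {ι : Type*} [Fintype ι] {X : ι → Type*} [∀ i, MeasurableSpace (X i)]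
    (μ : ∀ i, Measure (X i)) [∀ i, IsProbabilityMeasure (μ i)] (f : ∀ i, X i → ℝ≥0∞)
    (hf : ∀ i, Measurable (f i)) :
    ∫⁻ x, ∏ i, f i (x i) ∂(Measure.pi μ) = ∏ i, ∫⁻ t, f i t ∂(μ i) := by
  rw [lintegral_prod_eq_prod_lintegral_of_indepFun Finset.univ (fun i (x : ∀ i, X i) => f i (x i))
    (iIndepFun_pi fun i => (hf i).aemeasurable) fun i => (hf i).comp (measurable_pi_apply i)]
  refine Finset.prod_congr rfl fun i _ => ?_
  rw [← (measurePreserving_eval μ i).lintegral_comp (hf i)]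

theorem pi {ι : Type*} [Fintype ι] {P Q : ι → Measure ℝ} [∀ i, IsProbabilityMeasure (P i)]
    [∀ i, IsProbabilityMeasure (Q i)] {h : ι → ℕ → ℝ≥0} (H : ∀ i, MomentBound (P i) (Q i) (h i)) :
    MomentBound (Measure.pi P) (Measure.pi Q) (fun v => ∏ i, h i v) := by
  choose ρ hm h0 hP hv using H
  have hmp : ∀ i, Measurable fun x : ι → ℝ => ρ i (x i) := fun i =>
    (hm i).comp (measurable_pi_apply i)
  refine ⟨fun x => ∏ i, ρ i (x i), Finset.measurable_fun_prod _ fun i _ => hmp i,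
    fun x => Finset.prod_ne_zero_iff.2 fun i _ => h0 i _, ?_, fun v => ?_⟩
  -- It suffices to compare on boxes, where the indicator factors over the coordinates.
  · refine Measure.pi_eq fun s hs => ?_
    rw [withDensity_apply _ (MeasurableSet.univ_pi hs),
      ← lintegral_indicator (MeasurableSet.univ_pi hs)]
    have : ∀ x : ι → ℝ, (Set.univ.pi s).indicator
        (fun x => ((∏ i, ρ i (x i) : ℝ≥0) : ℝ≥0∞)) x =
        ∏ i, (s i).indicator (fun t => (ρ i t : ℝ≥0∞)) (x i) := fun x => by
      by_cases hx : x ∈ Set.univ.pi s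
      · rw [Set.indicator_of_mem hx]
        push_cast
        exact Finset.prod_congr rfl fun i _ =>
          (Set.indicator_of_mem (hx i (Set.mem_univ i)) (fun t => (ρ i t : ℝ≥0∞))).symm
      · rw [Set.indicator_of_notMem hx]
        simp only [Set.mem_univ_pi, not_forall] at hx
        obtain ⟨i, hi⟩ := hx
        exact (Finset.prod_eq_zero (Finset.mem_univ i) (Set.indicator_of_notMem hi _)).symm
    simp_rw [this]
    rw [prod_lintegral Q _ fun i => (hm i).coe_nnreal_ennreal.indicator (hs i)]
    refine Finset.prod_congr rfl fun i _ => ?_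
    rw [lintegral_indicator (hs i), hP i, withDensity_apply _ (hs i)]
  · have e1 : ∀ x : ι → ℝ, (((∏ i, ρ i (x i)) ^ v : ℝ≥0) : ℝ≥0∞) =
        ∏ i, ((ρ i (x i) ^ v : ℝ≥0) : ℝ≥0∞) := fun x => by
      rw [← Finset.prod_pow, ENNReal.ofNNReal_finsetProd]
    have e2 : ∀ x : ι → ℝ, (((∏ i, ρ i (x i)) * (∏ i, ρ i (x i))⁻¹ ^ v : ℝ≥0) : ℝ≥0∞) =
        ∏ i, ((ρ i (x i) * (ρ i (x i))⁻¹ ^ v : ℝ≥0) : ℝ≥0∞) := fun x => by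
      rw [← Finset.prod_inv_distrib, ← Finset.prod_pow, ← Finset.prod_mul_distrib,
        ENNReal.ofNNReal_finsetProd]
    simp_rw [e1, e2]
    rw [prod_lintegral Q (fun i t => ((ρ i t ^ v : ℝ≥0) : ℝ≥0∞))
        fun i => ((hm i).pow_const v).coe_nnreal_ennreal,
      prod_lintegral Q (fun i t => ((ρ i t * (ρ i t)⁻¹ ^ v : ℝ≥0) : ℝ≥0∞))
        fun i => ((hm i).mul ((hm i).inv.pow_const v)).coe_nnreal_ennreal]
    push_cast [-ENNReal.coe_pow, -ENNReal.coe_mul]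
    exact ⟨Finset.prod_le_prod' fun i _ => (hv i v).1, Finset.prod_le_prod' fun i _ => (hv i v).2⟩

end MomentBound

/-! ### Mixing a measure into its partner -/

/-- The moment bound after mixing with weights `p` and `q`. -/
noncomputable def mixBound (p q : ℝ≥0) (h : ℕ → ℝ≥0) (v : ℕ) : ℝ≥0 :=
  ∑ l ∈ Finset.range (v + 1), q ^ l * p ^ (v - l) * (v.choose l : ℝ≥0) * h l

theorem isProbabilityMeasure_mix {Ω : Type*} [MeasurableSpace Ω] {P Q : Measure Ω}
    [IsProbabilityMeasure P] [IsProbabilityMeasure Q] {p q : ℝ≥0} (hpq : p + q = 1) :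
    IsProbabilityMeasure ((p : ℝ≥0∞) • Q + (q : ℝ≥0∞) • P) := by
  constructor
  simp only [Measure.add_apply, Measure.smul_apply, measure_univ, smul_eq_mul, mul_one]
  exact_mod_cast hpq

theorem lintegral_sum_mul_le {Ω : Type*} [MeasurableSpace Ω] {Q : Measure Ω} {ι : Type*}
    (s : Finset ι) (c k : ι → ℝ≥0) {f : ι → Ω → ℝ≥0} (hf : ∀ i, Measurable (f i))
    (hk : ∀ i, ∫⁻ x, (f i x : ℝ≥0∞) ∂Q ≤ k i) :
    ∫⁻ x, (∑ i ∈ s, c i * f i x : ℝ≥0) ∂Q ≤ (∑ i ∈ s, c i * k i : ℝ≥0) := by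
  have hm : ∀ i ∈ s, Measurable fun x => ((c i * f i x : ℝ≥0) : ℝ≥0∞) := fun i _ =>
    ((hf i).const_mul (c i)).coe_nnreal_ennreal
  simp_rw [ENNReal.ofNNReal_finsetSum]
  rw [lintegral_finsetSum _ hm]
  refine Finset.sum_le_sum fun i _ => ?_
  simp_rw [ENNReal.coe_mul]
  rw [lintegral_const_mul _ (hf i).coe_nnreal_ennreal]
  exact mul_le_mul_right (hk i) _

namespace MomentBound

/-- The forward moments (`hA`) and those of `p + q dQ/dP` under `P` (`hB`) expand binomially. The
reversed moments follow by integrating the pointwise inequality `exists_nnreal_reverse_mix_le`. -/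
theorem mix {Ω : Type*} [MeasurableSpace Ω] {P Q : Measure Ω} {h : ℕ → ℝ≥0}
    [IsProbabilityMeasure P] [IsProbabilityMeasure Q] {p q : ℝ≥0} (hpq : p + q = 1)
    (H : MomentBound P Q h) :
    MomentBound ((p : ℝ≥0∞) • Q + (q : ℝ≥0∞) • P) Q (mixBound p q h) := by
  obtain ⟨ρ, hm, h0, hP, hv⟩ := H
  have ha0 : ∀ x, p + q * ρ x ≠ 0 := fun x h => by
    rw [add_eq_zero, mul_eq_zero, or_iff_left (h0 x)] at h
    rw [h.1, h.2] at hpq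
    simp at hpq
  have hρ1 : ∫⁻ x, (ρ x : ℝ≥0∞) ∂Q = 1 := by
    have : P Set.univ = 1 := measure_univ
    rwa [hP, withDensity_apply _ MeasurableSet.univ, Measure.restrict_univ] at this
  have hA : ∀ v, ∫⁻ x, ((p + q * ρ x) ^ v : ℝ≥0) ∂Q ≤ mixBound p q h v := fun v => by
    refine le_trans (le_of_eq ?_) (lintegral_sum_mul_le (Finset.range (v + 1))
      (fun l => q ^ l * p ^ (v - l) * (v.choose l : ℝ≥0)) h
      (fun l => hm.pow_const l) fun l => (hv l).1)
    refine lintegral_congr fun x => ?_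
    rw [add_comm p, add_pow]
    congr 1
    refine Finset.sum_congr rfl fun l _ => ?_
    ring
  have hB : ∀ v, ∫⁻ x, (ρ x * (p + q * (ρ x)⁻¹) ^ v : ℝ≥0) ∂Q ≤ mixBound p q h v := fun v => by
    refine le_trans (le_of_eq ?_) (lintegral_sum_mul_le (Finset.range (v + 1))
      (fun l => q ^ l * p ^ (v - l) * (v.choose l : ℝ≥0)) h
      (f := fun l x => ρ x * (ρ x)⁻¹ ^ l) (fun l => hm.mul (hm.inv.pow_const l)) fun l => (hv l).2)
    refine lintegral_congr fun x => ?_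
    rw [add_comm p, add_pow, Finset.mul_sum]
    congr 1
    refine Finset.sum_congr rfl fun l _ => ?_
    rw [mul_pow]
    ring
  refine ⟨fun x => p + q * ρ x, by fun_prop, ha0, ?_, fun v => ⟨hA v, ?_⟩⟩
  · rw [hP, ← withDensity_const, ← withDensity_smul _ hm.coe_nnreal_ennreal,
      ← withDensity_add_left measurable_const]
    simp [Pi.add_def]
  have one_le : 1 ≤ (mixBound p q h 0 : ℝ≥0∞) ∧ 1 ≤ (mixBound p q h 1 : ℝ≥0∞) := by
    refine ⟨by simpa using hA 0, le_trans (le_of_eq ?_) (hA 1)⟩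
    simp_rw [pow_one, ENNReal.coe_add, ENNReal.coe_mul]
    rw [lintegral_add_left measurable_const, lintegral_const_mul _ hm.coe_nnreal_ennreal, hρ1,
      lintegral_const, measure_univ, mul_one, mul_one]
    exact_mod_cast hpq.symm
  -- Reversed moments of order `0` and `1` are total masses, equal to `1`; the pointwise inequality
  -- starts at order `2`.
  match v with
  | 0 =>
    refine le_trans (le_of_eq ?_) one_le.1
    simp_rw [pow_zero, mul_one, ENNReal.coe_add, ENNReal.coe_mul]
    rw [lintegral_add_left measurable_const, lintegral_const_mul _ hm.coe_nnreal_ennreal, hρ1,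
      lintegral_const, measure_univ, mul_one, mul_one]
    exact_mod_cast hpq
  | 1 =>
    refine le_trans (le_of_eq ?_) one_le.2
    simp_rw [pow_one, mul_inv_cancel₀ (ha0 _)]
    simp
  | n + 2 =>
    obtain ⟨l, l', c, c', hl, hw⟩ := exists_nnreal_reverse_mix_le n hpq
    have e : ∀ x, (p + q * ρ x) * (p + q * ρ x)⁻¹ ^ (n + 2) = (p + q * ρ x)⁻¹ ^ (n + 1) :=
      fun x => by rw [pow_succ' _ (n + 1), mul_inv_cancel_left₀ (ha0 x)]
    simp_rw [e]
    have ha : Measurable fun x => p + q * ρ x := by fun_prop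
    have hb : Measurable fun x => p + q * (ρ x)⁻¹ := (hm.inv.const_mul q).const_add p
    have m1 : Measurable fun x => (((p + q * ρ x)⁻¹ ^ (n + 1) : ℝ≥0) : ℝ≥0∞) :=
      (ha.inv.pow_const (n + 1)).coe_nnreal_ennreal
    have m2 : Measurable fun x => (((p + q * ρ x) ^ (n + 2) : ℝ≥0) : ℝ≥0∞) :=
      (ha.pow_const (n + 2)).coe_nnreal_ennreal
    have m3 : Measurable fun x => ((ρ x * (p + q * (ρ x)⁻¹) ^ (n + 2) : ℝ≥0) : ℝ≥0∞) :=
      (hm.mul (hb.pow_const (n + 2))).coe_nnreal_ennreal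
    have m4 := hm.coe_nnreal_ennreal
    have key : ∫⁻ x, ((p + q * ρ x)⁻¹ ^ (n + 1) : ℝ≥0) ∂Q + c + c' ≤
        l * ∫⁻ x, ((p + q * ρ x) ^ (n + 2) : ℝ≥0) ∂Q +
        l' * ∫⁻ x, (ρ x * (p + q * (ρ x)⁻¹) ^ (n + 2) : ℝ≥0) ∂Q + c' + c := by
      have hmono := lintegral_mono (μ := Q) fun x => ENNReal.coe_le_coe.2 (hw (ρ x) (h0 x))
      simp only [ENNReal.coe_add, ENNReal.coe_mul c, ENNReal.coe_mul c', ENNReal.coe_mul l,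
        ENNReal.coe_mul l'] at hmono
      rwa [lintegral_add_right _ measurable_const, lintegral_add_left m1,
        lintegral_const_mul _ m4, lintegral_add_right _ measurable_const,
        lintegral_add_right _ (m4.const_mul _), lintegral_add_left (m2.const_mul _),
        lintegral_const_mul _ m2, lintegral_const_mul _ m3, lintegral_const_mul _ m4, hρ1,
        lintegral_const, lintegral_const, measure_univ, mul_one, mul_one] at hmono
    have k2 : (l : ℝ≥0∞) * ∫⁻ x, ((p + q * ρ x) ^ (n + 2) : ℝ≥0) ∂Q +
        l' * ∫⁻ x, (ρ x * (p + q * (ρ x)⁻¹) ^ (n + 2) : ℝ≥0) ∂Q ≤ mixBound p q h (n + 2) := by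
      refine (add_le_add (mul_le_mul_right (hA _) _) (mul_le_mul_right (hB _) _)).trans ?_
      rw [← add_mul, ← ENNReal.coe_add, hl, ENNReal.coe_one, one_mul]
    -- Because `ρ` integrates to `1`, the linear terms contribute the same finite constant `c + c'`
    -- to both sides.
    have k3 := key.trans (add_le_add_left (add_le_add_left k2 c') c)
    rw [add_assoc, add_assoc, add_comm (c' : ℝ≥0∞)] at k3
    exact (ENNReal.add_le_add_iff_right (by simp)).1 k3

end MomentBound

/-! ### Gaussian noise -/

/-- The Gaussian moment generating function at `n y / V`. The exponent `n` is real so that it covers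
both `v` and `1 - v`; the result is invariant under `n ↦ 1 - n`, which is why both moments of a
Gaussian pair agree. -/
theorem lintegral_exp_gaussianReal (a y : ℝ) {V : ℝ≥0} (hV : V ≠ 0) (n : ℝ) :
    ∫⁻ z, ENNReal.ofReal (Real.exp (n * ((z - a) * y / V - y ^ 2 / (2 * V)))) ∂(gaussianReal a V) =
      ENNReal.ofReal (Real.exp (n * (n - 1) * y ^ 2 / (2 * V))) := by
  have hV' : (V : ℝ) ≠ 0 := by exact_mod_cast hV
  have e : ∀ z, Real.exp (n * ((z - a) * y / V - y ^ 2 / (2 * V))) =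
      Real.exp (-(n * a * y / V) - n * y ^ 2 / (2 * V)) * Real.exp (n * y / V * z) := fun z => by
    rw [← Real.exp_add]
    congr 1
    field_simp
    ring
  have hi := (integrable_exp_mul_gaussianReal (μ := a) (v := V) (n * y / V)).const_mul
    (Real.exp (-(n * a * y / V) - n * y ^ 2 / (2 * V)))
  simp_rw [e]
  rw [← ofReal_integral_eq_lintegral_ofReal hi (ae_of_all _ fun z => by positivity),
    integral_const_mul]
  have hmgf := congrFun (mgf_fun_id_gaussianReal (μ := a) (v := V)) (n * y / V)
  rw [mgf] at hmgf
  rw [hmgf, ← Real.exp_add]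
  congr 2
  field_simp
  ring

/-- The moments of the likelihood ratio of two Gaussians of variance `V` with means at
distance `y`. -/
noncomputable def gaussianBound (y : ℝ) (V : ℝ≥0) (l : ℕ) : ℝ≥0 :=
  (Real.exp ((l : ℝ) * (l - 1) * y ^ 2 / (2 * V))).toNNReal

theorem momentBound_gaussianReal (a y : ℝ) {V : ℝ≥0} (hV : V ≠ 0) :
    MomentBound (gaussianReal (a + y) V) (gaussianReal a V) (gaussianBound y V) := by
  have hV' : (V : ℝ) ≠ 0 := by exact_mod_cast hV
  set f : ℝ → ℝ := fun z => (z - a) * y / V - y ^ 2 / (2 * V) with hf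
  have hρ : Measurable fun z => (Real.exp (f z)).toNNReal := by fun_prop
  have hpos : ∀ z, (Real.exp (f z)).toNNReal ≠ 0 := fun z => by
    simpa using Real.exp_pos (f z)
  refine ⟨fun z => (Real.exp (f z)).toNNReal, hρ, hpos, ?_, fun v => ?_⟩
  · rw [gaussianReal_of_var_ne_zero _ hV, gaussianReal_of_var_ne_zero _ hV,
      ← withDensity_mul _ (measurable_gaussianPDF _ _) hρ.coe_nnreal_ennreal]
    congr 1
    ext z
    simp only [gaussianPDF, Pi.mul_apply, ENNReal.ofReal]
    rw [← ENNReal.coe_mul, ← Real.toNNReal_mul (gaussianPDFReal_nonneg _ _ _), gaussianPDFReal,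
      gaussianPDFReal, mul_assoc _ (Real.exp _), ← Real.exp_add, hf]
    congr 5
    field_simp
    ring
  · have h1 := lintegral_exp_gaussianReal a y hV v
    have h2 := lintegral_exp_gaussianReal a y hV (1 - v)
    have e1 : ∀ z, (((Real.exp (f z)).toNNReal ^ v : ℝ≥0) : ℝ≥0∞) =
        ENNReal.ofReal (Real.exp (v * f z)) := fun z => by
      rw [ENNReal.ofReal, Real.exp_nat_mul, Real.toNNReal_pow (Real.exp_pos _).le]
    have e2 : ∀ z, (((Real.exp (f z)).toNNReal * (Real.exp (f z)).toNNReal⁻¹ ^ v : ℝ≥0) : ℝ≥0∞) =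
        ENNReal.ofReal (Real.exp ((1 - v) * f z)) := fun z => by
      rw [ENNReal.ofReal, ← Real.toNNReal_inv, ← Real.exp_neg,
        ← Real.toNNReal_pow (Real.exp_pos _).le, ← Real.exp_nat_mul,
        ← Real.toNNReal_mul (Real.exp_pos _).le, ← Real.exp_add]
      congr 3
      ring
    simp_rw [e1, e2]
    refine ⟨h1.le, h2.le.trans (le_of_eq ?_)⟩
    rw [gaussianBound, ENNReal.ofReal]
    congr 4
    ring

/-! ### Poisson sampling -/

section Poisson

variable {𝒳 Ω : Type*} [MeasurableSpace Ω] {q : ℝ}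

theorem toNNReal_one_sub_add (hq : q ∈ Set.Icc (0 : ℝ) 1) :
    (1 - q).toNNReal + q.toNNReal = 1 := by
  rw [← Real.toNNReal_add (by linarith [hq.2]) hq.1]
  simp

theorem poissonSample_zero (κ : Multiset 𝒳 → Measure Ω) : poissonSample q κ 0 = κ 0 := by
  simp [poissonSample]

/-- Condition on whether `x` is drawn. -/
theorem poissonSample_cons (hq : q ∈ Set.Icc (0 : ℝ) 1) (κ : Multiset 𝒳 → Measure Ω) (x : 𝒳)
    (X : Multiset 𝒳) :
    poissonSample q κ (x ::ₘ X) = ((1 - q).toNNReal : ℝ≥0∞) • poissonSample q κ X +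
      (q.toNNReal : ℝ≥0∞) • poissonSample q (fun S => κ (x ::ₘ S)) X := by
  have h1 : 0 ≤ 1 - q := by linarith [hq.2]
  simp only [poissonSample, Multiset.powerset_cons, Multiset.map_add, Multiset.sum_add,
    Multiset.map_map, Multiset.smul_sum, Function.comp_def]
  congr 2
  · refine Multiset.map_congr rfl fun S hS => ?_
    -- Needed because the exponent `X.card + 1 - S.card` is a truncated subtraction.
    have hc := Multiset.card_le_card (Multiset.mem_powerset.1 hS)
    rw [smul_smul, ← ENNReal.ofReal, ← ENNReal.ofReal_mul h1, Multiset.card_cons,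
      Nat.succ_sub hc, pow_succ]
    congr 2
    ring
  · refine Multiset.map_congr rfl fun S hS => ?_
    rw [smul_smul, ← ENNReal.ofReal, ← ENNReal.ofReal_mul hq.1, Multiset.card_cons,
      Multiset.card_cons, Nat.add_sub_add_right, pow_succ]
    congr 2
    ring

/-- Deciding about `x` after the others are sampled lets the two datasets share the sample `S`, so
they can be compared for each `S` separately. -/
theorem poissonSample_cons_eq_mix (hq : q ∈ Set.Icc (0 : ℝ) 1) (κ : Multiset 𝒳 → Measure Ω) (x : 𝒳)
    (X : Multiset 𝒳) :
    poissonSample q κ (x ::ₘ X) = poissonSample q (fun S =>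
      ((1 - q).toNNReal : ℝ≥0∞) • κ S + (q.toNNReal : ℝ≥0∞) • κ (x ::ₘ S)) X := by
  rw [poissonSample_cons hq]
  simp only [poissonSample, Multiset.smul_sum, Multiset.map_map, ← Multiset.sum_map_add,
    Function.comp_def, smul_add]
  congr 2
  ext S : 1
  rw [smul_comm, smul_comm (q.toNNReal : ℝ≥0∞)]

theorem isProbabilityMeasure_poissonSample (hq : q ∈ Set.Icc (0 : ℝ) 1) (X : Multiset 𝒳)
    (κ : Multiset 𝒳 → Measure Ω) (hκ : ∀ S, IsProbabilityMeasure (κ S)) :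
    IsProbabilityMeasure (poissonSample q κ X) := by
  induction X using Multiset.induction generalizing κ with
  | empty => rw [poissonSample_zero]; exact hκ 0
  | cons x X ih =>
    rw [poissonSample_cons hq]
    have := ih κ hκ
    have := ih (fun S => κ (x ::ₘ S)) fun S => hκ _
    exact isProbabilityMeasure_mix (toNNReal_one_sub_add hq)

/-- A bound common to all `S` survives averaging: the weights of each induction step add up to `1`.
-/
theorem MomentBound.poissonSample (hq : q ∈ Set.Icc (0 : ℝ) 1) {h : ℕ → ℝ≥0} (X : Multiset 𝒳)
    (κ κ' : Multiset 𝒳 → Measure Ω) (hκ : ∀ S, IsProbabilityMeasure (κ S))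
    (H : ∀ S, MomentBound (κ' S) (κ S) h) :
    MomentBound (poissonSample q κ' X) (poissonSample q κ X) h := by
  induction X using Multiset.induction generalizing κ κ' with
  | empty => rw [poissonSample_zero, poissonSample_zero]; exact H 0
  | cons x X ih =>
    rw [poissonSample_cons hq, poissonSample_cons hq]
    have := isProbabilityMeasure_poissonSample hq X κ hκ
    have := isProbabilityMeasure_poissonSample hq X (fun S => κ (x ::ₘ S)) fun S => hκ _
    have i1 : IsFiniteMeasure (((1 - q).toNNReal : ℝ≥0∞) • HybridTwice.poissonSample q κ X) :=
      Measure.smul_finite _ ENNReal.coe_ne_top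
    have i2 : IsFiniteMeasure ((q.toNNReal : ℝ≥0∞) •
        HybridTwice.poissonSample q (fun S => κ (x ::ₘ S)) X) :=
      Measure.smul_finite _ ENNReal.coe_ne_top
    refine (((ih κ κ' hκ H).smul _).add ((ih (fun S => κ (x ::ₘ S)) (fun S => κ' (x ::ₘ S))
      (fun S => hκ _) fun S => H _).smul _)).mono fun v => ?_
    rw [← add_mul, toNNReal_one_sub_add hq, one_mul]

theorem MomentBound.poissonSample_cons (hq : q ∈ Set.Icc (0 : ℝ) 1) {h : ℕ → ℝ≥0} (x : 𝒳)
    (X : Multiset 𝒳) (κ : Multiset 𝒳 → Measure Ω) (hκ : ∀ S, IsProbabilityMeasure (κ S))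
    (H : ∀ S, MomentBound (κ (x ::ₘ S)) (κ S) h) :
    MomentBound (HybridTwice.poissonSample q κ (x ::ₘ X)) (HybridTwice.poissonSample q κ X)
      (mixBound (1 - q).toNNReal q.toNNReal h) := by
  rw [poissonSample_cons_eq_mix hq]
  exact MomentBound.poissonSample hq X _ _ hκ fun S => (H S).mix (toNNReal_one_sub_add hq)

theorem renyiDiv_le {P Q : Measure Ω} [IsFiniteMeasure Q] {h : ℕ → ℝ≥0} (H : MomentBound P Q h)
    {α : ℕ} (hα : 2 ≤ α) {ε : ℝ} (hε : (h α : ℝ) ≤ Real.exp ((α - 1) * ε)) :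
    renyiDiv α P Q ≤ (ε : EReal) := by
  obtain ⟨ρ, hm, h0, rfl, hv⟩ := H
  have hα' : (0 : ℝ) < α - 1 := by
    have : (2 : ℝ) ≤ α := by exact_mod_cast hα
    linarith
  rw [renyiDiv, if_pos (withDensity_absolutelyContinuous _ _)]
  have hI : ∫⁻ o, ((Q.withDensity fun x => (ρ x : ℝ≥0∞)).rnDeriv Q o) ^ (α : ℝ) ∂Q ≤
      ENNReal.ofReal (Real.exp ((α - 1) * ε)) := by
    refine le_trans (le_of_eq ?_) ((hv α).1.trans ?_)
    · refine lintegral_congr_ae ?_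
      filter_upwards [Measure.rnDeriv_withDensity Q hm.coe_nnreal_ennreal] with x hx
      rw [hx, ENNReal.rpow_natCast, ENNReal.coe_pow]
    · rw [ENNReal.ofReal]
      exact ENNReal.coe_le_coe.2 (NNReal.le_toNNReal_of_coe_le hε)
  have hlog := ENNReal.log_le_log hI
  rw [ENNReal.log_ofReal_of_pos (Real.exp_pos _), Real.log_exp] at hlog
  refine (mul_le_mul_of_nonneg_left hlog (by exact_mod_cast (inv_pos.2 hα').le)).trans ?_
  rw [← EReal.coe_mul, inv_mul_cancel_left₀ hα'.ne']

end Poisson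

/-! ### Binomial averages of exponentials -/

/-- The average of `exp (k l)` over the binomial distribution of `l`. -/
noncomputable def binExp (q : ℝ) (k : ℕ → ℝ) (v : ℕ) : ℝ :=
  ∑ l ∈ Finset.range (v + 1), q ^ l * (1 - q) ^ (v - l) * (v.choose l : ℝ) * Real.exp (k l)

section BinExp

variable {q : ℝ}

theorem binomial_weight_nonneg (hq : q ∈ Set.Icc (0 : ℝ) 1) (v l : ℕ) :
    0 ≤ q ^ l * (1 - q) ^ (v - l) * (v.choose l : ℝ) := by
  have := hq.1
  have : 0 ≤ 1 - q := by linarith [hq.2]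
  positivity

theorem sum_binomial_weight (q : ℝ) (v : ℕ) :
    ∑ l ∈ Finset.range (v + 1), q ^ l * (1 - q) ^ (v - l) * (v.choose l : ℝ) = 1 := by
  rw [← add_pow, add_sub_cancel, one_pow]

theorem binExp_zero (q : ℝ) (v : ℕ) : binExp q 0 v = 1 := by
  simpa [binExp] using sum_binomial_weight q v

theorem binExp_mono (hq : q ∈ Set.Icc (0 : ℝ) 1) {k k' : ℕ → ℝ} (h : ∀ l, k l ≤ k' l) (v : ℕ) :
    binExp q k v ≤ binExp q k' v :=
  Finset.sum_le_sum fun l _ => mul_le_mul_of_nonneg_left (Real.exp_le_exp.2 (h l))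
    (binomial_weight_nonneg hq v l)

theorem one_le_binExp (hq : q ∈ Set.Icc (0 : ℝ) 1) {k : ℕ → ℝ} (h : ∀ l, 0 ≤ k l) (v : ℕ) :
    1 ≤ binExp q k v := by
  rw [← binExp_zero q v]
  exact binExp_mono hq h v

theorem binExp_pos (hq : q ∈ Set.Icc (0 : ℝ) 1) (k : ℕ → ℝ) (v : ℕ) : 0 < binExp q k v := by
  have h : ∀ l ∈ Finset.range (v + 1), 0 ≤ q ^ l * (1 - q) ^ (v - l) * (v.choose l : ℝ) *
      Real.exp (k l) := fun l _ => mul_nonneg (binomial_weight_nonneg hq v l) (Real.exp_pos _).le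
  refine (Finset.sum_nonneg h).lt_of_ne' fun h0 => ?_
  rw [Finset.sum_eq_zero_iff_of_nonneg h] at h0
  have : ∑ l ∈ Finset.range (v + 1), q ^ l * (1 - q) ^ (v - l) * (v.choose l : ℝ) = 0 :=
    Finset.sum_eq_zero fun l hl => (mul_eq_zero.1 (h0 l hl)).resolve_right (Real.exp_pos _).ne'
  rw [sum_binomial_weight] at this
  exact one_ne_zero this

/-- Jensen for the concave function `t ↦ t ^ θ` and the binomial weights. -/
theorem binExp_mul_le_rpow (hq : q ∈ Set.Icc (0 : ℝ) 1) (k : ℕ → ℝ) (v : ℕ) {θ : ℝ}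
    (hθ0 : 0 ≤ θ) (hθ1 : θ ≤ 1) : binExp q (fun l => θ * k l) v ≤ binExp q k v ^ θ := by
  have := (Real.concaveOn_rpow hθ0 hθ1).le_map_sum
    (t := Finset.range (v + 1)) (p := fun l => Real.exp (k l))
    (fun l _ => binomial_weight_nonneg hq v l) (sum_binomial_weight q v)
    (fun l _ => (Real.exp_pos _).le)
  simp only [smul_eq_mul] at this
  refine le_trans (le_of_eq ?_) this
  refine Finset.sum_congr rfl fun l _ => ?_
  rw [← Real.exp_mul, mul_comm (k l)]

theorem binExp_eq_add (q : ℝ) {k : ℕ → ℝ} (hk : k 0 = 0) (v : ℕ) :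
    (1 - q) ^ v + ∑ l ∈ Finset.Icc 1 v,
      (v.choose l : ℝ) * (1 - q) ^ (v - l) * q ^ l * Real.exp (k l) = binExp q k v := by
  rw [binExp, Finset.sum_range_succ', add_comm, Finset.range_eq_Ico,
    Finset.sum_Ico_add' (fun l => q ^ l * (1 - q) ^ (v - l) * (v.choose l : ℝ) * Real.exp (k l))]
  congr 1
  · refine Finset.sum_congr (by ext; simp) fun l _ => by ring
  · simp [hk]

/-- Keeping only the top term shows that a bounded average forces a bounded exponent, hence noise
bounded below. -/
theorem last_le_binExp (hq : q ∈ Set.Icc (0 : ℝ) 1) (k : ℕ → ℝ) (v : ℕ) :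
    q ^ v * Real.exp (k v) ≤ binExp q k v := by
  have := Finset.single_le_sum (f := fun l => q ^ l * (1 - q) ^ (v - l) * (v.choose l : ℝ) *
    Real.exp (k l)) (s := Finset.range (v + 1))
    (fun l _ => mul_nonneg (binomial_weight_nonneg hq v l) (Real.exp_pos _).le)
    (Finset.self_mem_range_succ v)
  simpa [binExp] using this

theorem continuous_binExp {Y : Type*} [TopologicalSpace Y] (q : ℝ) {k : Y → ℕ → ℝ}
    (hk : ∀ l, Continuous fun y => k y l) (v : ℕ) : Continuous fun y => binExp q (k y) v :=
  continuous_finsetSum _ fun l _ => continuous_const.mul (Real.continuous_exp.comp (hk l))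

/-- The moment bound of a sampled coordinate, where `s` is half of the squared ratio of
sensitivity and noise. -/
noncomputable def coordBound (q s : ℝ) (v : ℕ) : ℝ :=
  binExp q (fun l => (l : ℝ) * ((l : ℝ) - 1) * s) v

theorem cast_mul_sub_one_nonneg (l : ℕ) : 0 ≤ (l : ℝ) * ((l : ℝ) - 1) := by
  rcases l with _ | l
  · simp
  · push_cast
    rw [add_sub_cancel_right]
    positivity

theorem coordBound_pos (hq : q ∈ Set.Icc (0 : ℝ) 1) (s : ℝ) (v : ℕ) : 0 < coordBound q s v :=
  binExp_pos hq _ v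

theorem one_le_coordBound (hq : q ∈ Set.Icc (0 : ℝ) 1) {s : ℝ} (hs : 0 ≤ s) (v : ℕ) :
    1 ≤ coordBound q s v :=
  one_le_binExp hq (fun l => mul_nonneg (cast_mul_sub_one_nonneg l) hs) v

theorem coordBound_zero_right (q s : ℝ) : coordBound q s 0 = 1 := by simp [coordBound, binExp]

theorem coordBound_one_right (q s : ℝ) : coordBound q s 1 = 1 := by
  simp [coordBound, binExp, Finset.sum_range_succ]

theorem coordBound_zero (q : ℝ) (v : ℕ) : coordBound q 0 v = 1 := by
  simpa [coordBound, Pi.zero_def] using binExp_zero q v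

theorem coordBound_mul_le_rpow (hq : q ∈ Set.Icc (0 : ℝ) 1) (s : ℝ) (v : ℕ) {θ : ℝ}
    (hθ0 : 0 ≤ θ) (hθ1 : θ ≤ 1) : coordBound q (θ * s) v ≤ coordBound q s v ^ θ := by
  refine le_trans (le_of_eq ?_) (binExp_mul_le_rpow hq _ v hθ0 hθ1)
  rw [coordBound]
  congr 1
  ext l
  ring

theorem continuous_coordBound (q : ℝ) (v : ℕ) : Continuous fun s => coordBound q s v :=
  continuous_binExp q (fun _ => continuous_const.mul continuous_id) v

theorem coe_mixBound_gaussianBound (hq : q ∈ Set.Icc (0 : ℝ) 1) (y : ℝ) (V : ℝ≥0) (v : ℕ) :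
    (mixBound (1 - q).toNNReal q.toNNReal (gaussianBound y V) v : ℝ) =
      coordBound q (y ^ 2 / (2 * V)) v := by
  have h1 : 0 ≤ 1 - q := by linarith [hq.2]
  rw [mixBound, coordBound, binExp]
  push_cast
  refine Finset.sum_congr rfl fun l _ => ?_
  rw [Real.coe_toNNReal _ hq.1, Real.coe_toNNReal _ h1, gaussianBound,
    Real.coe_toNNReal _ (Real.exp_pos _).le, mul_div_assoc]

/-- Among the vectors with bounded coordinates and bounded squared norm, the sparse ones have the
largest product of moment bounds. -/
theorem prod_coordBound_le (hq : q ∈ Set.Icc (0 : ℝ) 1) {ι : Type*} [Fintype ι] {y : ι → ℝ}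
    {c d₀ V : ℝ} (hV : 0 ≤ V) (hc : 0 ≤ c) (hy : ∀ i, |y i| ≤ c)
    (hsum : ∑ i, y i ^ 2 ≤ d₀ * c ^ 2) (v : ℕ) :
    ∏ i, coordBound q (y i ^ 2 / (2 * V)) v ≤ coordBound q (c ^ 2 / (2 * V)) v ^ d₀ := by
  -- For `c = 0` the exponents `y i ^ 2 / c ^ 2` are meaningless, but then all `y i` vanish.
  rcases hc.eq_or_lt with rfl | hc
  · have h0 : ∀ i, y i = 0 := fun i => abs_nonpos_iff.1 (hy i)
    simp [h0, coordBound_zero]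
  · have hg := one_le_coordBound hq (show 0 ≤ c ^ 2 / (2 * V) by positivity) v
    have hg0 := zero_lt_one.trans_le hg
    have hi : ∀ i, coordBound q (y i ^ 2 / (2 * V)) v ≤
        coordBound q (c ^ 2 / (2 * V)) v ^ (y i ^ 2 / c ^ 2) := fun i => by
      refine le_trans (le_of_eq ?_) (coordBound_mul_le_rpow hq _ v (by positivity) ?_)
      · congr 1
        field_simp
      · rw [div_le_one (by positivity)]
        exact sq_le_sq' (by linarith [neg_abs_le (y i), hy i]) ((le_abs_self _).trans (hy i))
    refine (Finset.prod_le_prod (fun i _ => (coordBound_pos hq _ v).le) fun i _ => hi i).trans ?_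
    rw [← Real.rpow_sum_of_pos hg0]
    -- The base is at least `1`, so the exponent may be raised to `d₀`.
    refine Real.rpow_le_rpow_of_exponent_le hg ?_
    rw [← Finset.sum_div, div_le_iff₀ (by positivity)]
    exact hsum

end BinExp

/-! ### Clipping -/

section Clip

variable {V : Type*} [NormedAddCommGroup V] [NormedSpace ℝ V] {c : ℝ}

theorem norm_clip (hc : 0 ≤ c) (v : V) : ‖clip c v‖ = min 1 (c / ‖v‖) * ‖v‖ := by
  rw [clip, norm_smul, Real.norm_of_nonneg (by positivity)]

theorem norm_clip_le (hc : 0 ≤ c) (v : V) : ‖clip c v‖ ≤ c := by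
  rw [norm_clip hc]
  rcases eq_or_ne ‖v‖ 0 with h | h
  · rw [h, mul_zero]
    exact hc
  · refine (mul_le_mul_of_nonneg_right (min_le_right _ _) (norm_nonneg v)).trans ?_
    rw [div_mul_cancel₀ _ h]

theorem norm_clip_le_norm (hc : 0 ≤ c) (v : V) : ‖clip c v‖ ≤ ‖v‖ := by
  rw [norm_clip hc]
  exact mul_le_of_le_one_left (norm_nonneg v) (min_le_left _ _)

variable {d m : ℕ} {r : Fin m → ℕ}
  (b : OrthonormalBasis (Σ j : Fin m, Fin (r j)) ℝ (EuclideanSpace ℝ (Fin d)))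
  {c₂ cInf : Fin m → ℝ}

theorem abs_hybridClip_le (hc : ∀ j, 0 ≤ cInf j) (v : EuclideanSpace ℝ (Fin d))
    (i : Σ j : Fin m, Fin (r j)) : |hybridClip b c₂ cInf v i| ≤ cInf i.1 :=
  norm_clip_le (hc i.1) (b.repr (clip (c₂ i.1) (blockProj b i.1 v)) i)

/-- Clipping coordinates only shrinks them, so the norm bound from the first clipping survives;
Parseval converts it to coordinates. -/
theorem sum_sq_hybridClip_le (hc : ∀ j, 0 ≤ cInf j) (hc₂ : ∀ j, 0 ≤ c₂ j)
    (v : EuclideanSpace ℝ (Fin d)) (j : Fin m) :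
    ∑ l, hybridClip b c₂ cInf v ⟨j, l⟩ ^ 2 ≤ c₂ j ^ 2 := by
  set w := clip (c₂ j) (blockProj b j v) with hw
  have h1 : ∑ l, hybridClip b c₂ cInf v ⟨j, l⟩ ^ 2 ≤ ∑ l, b.repr w ⟨j, l⟩ ^ 2 := by
    refine Finset.sum_le_sum fun l _ => ?_
    rw [← sq_abs, ← sq_abs (b.repr w ⟨j, l⟩)]
    exact pow_le_pow_left₀ (abs_nonneg _) (norm_clip_le_norm (hc j) (b.repr w ⟨j, l⟩)) 2
  have h2 : ∑ l, b.repr w ⟨j, l⟩ ^ 2 ≤ ∑ i, b.repr w i ^ 2 := by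
    rw [← Finset.univ_sigma_univ, Finset.sum_sigma]
    exact Finset.single_le_sum (f := fun j => ∑ l, b.repr w ⟨j, l⟩ ^ 2)
      (fun j _ => Finset.sum_nonneg fun l _ => sq_nonneg _) (Finset.mem_univ j)
  have h3 : ∑ i, b.repr w i ^ 2 = ‖w‖ ^ 2 := by
    rw [← b.repr.norm_map w, EuclideanSpace.norm_sq_eq]
    simp
  rw [h3] at h2
  exact h1.trans (h2.trans (pow_le_pow_left₀ (norm_nonneg _) (norm_clip_le (hc₂ j) _) 2))

end Clip

/-! ### The privacy bound -/

section Bound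

variable {m : ℕ} {d₀ cInf : Fin m → ℝ} {q₁ q₂ : ℝ} {σ : Fin m → ℝ}

/-- The logarithm of the product of the moment bounds of all blocks. -/
noncomputable def logMoment (d₀ : Fin m → ℝ) (q₂ : ℝ) (s : Fin m → ℝ) (v : ℕ) : ℝ :=
  ∑ j, d₀ j * Real.log (coordBound q₂ (s j) v)

/-- Half of the squared ratio of sensitivity and noise. -/
noncomputable def halfSqRatio (cInf σ : Fin m → ℝ) (j : Fin m) : ℝ := cInf j ^ 2 / (2 * σ j ^ 2)

theorem halfSqRatio_nonneg (cInf σ : Fin m → ℝ) (j : Fin m) : 0 ≤ halfSqRatio cInf σ j := by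
  unfold halfSqRatio
  positivity

theorem sub_one_mul_epsZero (d₀ cInf : Fin m → ℝ) (q₂ : ℝ) (σ : Fin m → ℝ) (v : ℕ) :
    ((v : ℝ) - 1) * epsZero d₀ cInf q₂ σ v = logMoment d₀ q₂ (halfSqRatio cInf σ) v := by
  have e : ∀ j, (1 - q₂) ^ v + ∑ l ∈ Finset.Icc 1 v,
      (v.choose l : ℝ) * (1 - q₂) ^ (v - l) * q₂ ^ l *
        Real.exp ((l : ℝ) * ((l : ℝ) - 1) * cInf j ^ 2 / (2 * σ j ^ 2)) =
      coordBound q₂ (halfSqRatio cInf σ j) v := fun j => by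
    rw [coordBound, ← binExp_eq_add q₂ (by simp)]
    simp_rw [mul_div_assoc]
    rfl
  rw [epsZero, logMoment, Finset.mul_sum]
  refine Finset.sum_congr rfl fun j _ => ?_
  rw [e j]
  -- At `v = 1` nothing cancels, but both sides are zero since `coordBound q₂ s 1 = 1`.
  rcases eq_or_ne v 1 with rfl | hv
  · simp [coordBound_one_right]
  · have : (v : ℝ) - 1 ≠ 0 := sub_ne_zero.2 (by exact_mod_cast hv)
    field_simp

theorem twiceBound_epsZero (d₀ cInf : Fin m → ℝ) (q₁ q₂ : ℝ) (σ : Fin m → ℝ) (α : ℕ) :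
    twiceBound q₁ (epsZero d₀ cInf q₂ σ) α =
      Real.log (binExp q₁ (logMoment d₀ q₂ (halfSqRatio cInf σ)) α) / ((α : ℝ) - 1) := by
  rw [twiceBound, ← binExp_eq_add q₁ (by simp [logMoment, coordBound_zero_right])]
  simp_rw [sub_one_mul_epsZero]

theorem binExp_le_exp_of_twiceBound_le (hq₁ : q₁ ∈ Set.Icc (0 : ℝ) 1) {α : ℕ} (hα : 2 ≤ α) {ε : ℝ}
    (h : twiceBound q₁ (epsZero d₀ cInf q₂ σ) α ≤ ε) :
    binExp q₁ (logMoment d₀ q₂ (halfSqRatio cInf σ)) α ≤ Real.exp ((α - 1) * ε) := by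
  have hα' : (0 : ℝ) < α - 1 := by
    have : (2 : ℝ) ≤ α := by exact_mod_cast hα
    linarith
  rw [twiceBound_epsZero, div_le_iff₀ hα', mul_comm] at h
  exact (Real.log_le_iff_le_exp (binExp_pos hq₁ _ _)).1 h

theorem exp_logMoment (hq₂ : q₂ ∈ Set.Icc (0 : ℝ) 1) (d₀ s : Fin m → ℝ) (v : ℕ) :
    Real.exp (logMoment d₀ q₂ s v) = ∏ j, coordBound q₂ (s j) v ^ d₀ j := by
  rw [logMoment, Real.exp_sum]
  refine Finset.prod_congr rfl fun j _ => ?_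
  rw [Real.rpow_def_of_pos (coordBound_pos hq₂ _ v), mul_comm]

variable {𝒳 : Type*} {d : ℕ} {r : Fin m → ℕ}

/-- The moment bound of coordinate-wise sampling with noise `s` for a datapoint `y`. -/
noncomputable def datapointBound {ι : Type*} [Fintype ι] (q₂ : ℝ) (y s : ι → ℝ) (v : ℕ) : ℝ≥0 :=
  ∏ i, mixBound (1 - q₂).toNNReal q₂.toNNReal (gaussianBound (y i) (s i ^ 2).toNNReal) v

theorem momentBound_coordSampling_cons {ι : Type*} [Fintype ι] (hq₂ : q₂ ∈ Set.Icc (0 : ℝ) 1)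
    (y : 𝒳 → ι → ℝ) {s : ι → ℝ} (hs : ∀ i, 0 < s i) (x : 𝒳) (S : Multiset 𝒳) :
    MomentBound (coordSampling q₂ y s (x ::ₘ S)) (coordSampling q₂ y s S)
      (datapointBound q₂ (y x) s) := by
  have hp : ∀ i S, IsProbabilityMeasure (poissonSample q₂ (fun T : Multiset 𝒳 =>
      gaussianReal (T.map fun x => y x i).sum (Real.toNNReal (s i ^ 2))) S) := fun i S =>
    isProbabilityMeasure_poissonSample hq₂ S _ fun T => inferInstance
  refine MomentBound.pi fun i => ?_
  refine MomentBound.poissonSample_cons hq₂ x S _ (fun T => inferInstance) fun T => ?_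
  simp only [Multiset.map_cons, Multiset.sum_cons]
  rw [add_comm (y x i)]
  exact momentBound_gaussianReal _ _ (Real.toNNReal_pos.2 (pow_pos (hs i) 2)).ne'

theorem isProbabilityMeasure_coordSampling {ι : Type*} [Fintype ι] (hq₂ : q₂ ∈ Set.Icc (0 : ℝ) 1)
    (y : 𝒳 → ι → ℝ) (s : ι → ℝ) (S : Multiset 𝒳) :
    IsProbabilityMeasure (coordSampling q₂ y s S) := by
  have hp : ∀ i, IsProbabilityMeasure (poissonSample q₂ (fun T : Multiset 𝒳 =>
      gaussianReal (T.map fun x => y x i).sum (Real.toNNReal (s i ^ 2))) S) := fun i =>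
    isProbabilityMeasure_poissonSample hq₂ S _ fun T => inferInstance
  unfold coordSampling
  infer_instance

/-- The synthesis map of an orthonormal basis, as a measurable equivalence. -/
noncomputable def synthesisEquiv
    (b : OrthonormalBasis (Σ j : Fin m, Fin (r j)) ℝ (EuclideanSpace ℝ (Fin d))) :
    ((Σ j : Fin m, Fin (r j)) → ℝ) ≃ᵐ EuclideanSpace ℝ (Fin d) :=
  (MeasurableEquiv.toLp 2 _).trans b.repr.symm.toHomeomorph.toMeasurableEquiv

theorem coe_synthesisEquiv
    (b : OrthonormalBasis (Σ j : Fin m, Fin (r j)) ℝ (EuclideanSpace ℝ (Fin d))) :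
    ⇑(synthesisEquiv b) = fun o => ∑ i, o i • b i := by
  ext1 o
  exact (b.sum_repr_symm (WithLp.toLp 2 o)).symm

variable (F : 𝒳 → EuclideanSpace ℝ (Fin d))
  (b : OrthonormalBasis (Σ j : Fin m, Fin (r j)) ℝ (EuclideanSpace ℝ (Fin d)))
  {c₂ : Fin m → ℝ}

theorem isProbabilityMeasure_hybridTwiceSampling (hq₁ : q₁ ∈ Set.Icc (0 : ℝ) 1)
    (hq₂ : q₂ ∈ Set.Icc (0 : ℝ) 1) (X : Multiset 𝒳) :
    IsProbabilityMeasure (hybridTwiceSampling F b c₂ cInf q₁ q₂ σ X) := by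
  have := isProbabilityMeasure_poissonSample hq₁ X
    (coordSampling q₂ (fun x => hybridClip b c₂ cInf (F x)) (fun i => σ i.1))
    (isProbabilityMeasure_coordSampling hq₂ _ _)
  rw [hybridTwiceSampling, ← coe_synthesisEquiv]
  exact Measure.isProbabilityMeasure_map (synthesisEquiv b).measurable.aemeasurable

theorem momentBound_hybridTwiceSampling_cons (hq₁ : q₁ ∈ Set.Icc (0 : ℝ) 1)
    (hq₂ : q₂ ∈ Set.Icc (0 : ℝ) 1) (hσ : ∀ j, 0 < σ j) (x : 𝒳) (X : Multiset 𝒳) :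
    MomentBound (hybridTwiceSampling F b c₂ cInf q₁ q₂ σ (x ::ₘ X))
      (hybridTwiceSampling F b c₂ cInf q₁ q₂ σ X)
      (mixBound (1 - q₁).toNNReal q₁.toNNReal
        (datapointBound q₂ (hybridClip b c₂ cInf (F x)) fun i => σ i.1)) := by
  rw [hybridTwiceSampling, hybridTwiceSampling, ← coe_synthesisEquiv]
  refine MomentBound.map _ (MomentBound.poissonSample_cons hq₁ x X _
    (isProbabilityMeasure_coordSampling hq₂ _ _) fun S => ?_)
  exact momentBound_coordSampling_cons hq₂ (fun x => hybridClip b c₂ cInf (F x))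
    (s := fun i => σ i.1) (fun i => hσ i.1) x S

/-- The outer average is monotone in the inner moments, so `prod_coordBound_le` can be applied block
by block; `c₂ j ^ 2 = d₀ j * cInf j ^ 2` is the norm budget it asks for. -/
theorem mixBound_hybridClip_le (hd₀ : ∀ j, 0 ≤ d₀ j) (hcInf : ∀ j, 0 ≤ cInf j)
    (hc₂ : ∀ j, c₂ j = Real.sqrt (d₀ j) * cInf j) (hq₁ : q₁ ∈ Set.Icc (0 : ℝ) 1)
    (hq₂ : q₂ ∈ Set.Icc (0 : ℝ) 1) (u : EuclideanSpace ℝ (Fin d)) (α : ℕ) :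
    (mixBound (1 - q₁).toNNReal q₁.toNNReal
        (datapointBound q₂ (hybridClip b c₂ cInf u) fun i => σ i.1) α : ℝ) ≤
      binExp q₁ (logMoment d₀ q₂ (halfSqRatio cInf σ)) α := by
  have h1 : 0 ≤ 1 - q₁ := by linarith [hq₁.2]
  rw [mixBound, binExp]
  push_cast
  refine Finset.sum_le_sum fun v _ => ?_
  rw [Real.coe_toNNReal _ hq₁.1, Real.coe_toNNReal _ h1, exp_logMoment hq₂]
  refine mul_le_mul_of_nonneg_left ?_ (binomial_weight_nonneg hq₁ α v)
  rw [datapointBound, NNReal.coe_prod]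
  simp_rw [coe_mixBound_gaussianBound hq₂, Real.coe_toNNReal _ (sq_nonneg _)]
  rw [← Finset.univ_sigma_univ, Finset.prod_sigma]
  refine Finset.prod_le_prod
    (fun j _ => Finset.prod_nonneg fun l _ => (coordBound_pos hq₂ _ v).le) fun j _ => ?_
  have hc₂' : ∀ j, 0 ≤ c₂ j := fun j => by
    rw [hc₂]
    exact mul_nonneg (Real.sqrt_nonneg _) (hcInf j)
  refine prod_coordBound_le (y := fun l => hybridClip b c₂ cInf u ⟨j, l⟩) (c := cInf j)
    (d₀ := d₀ j) (V := σ j ^ 2) hq₂ (sq_nonneg _) (hcInf j)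
    (fun l => abs_hybridClip_le b hcInf u ⟨j, l⟩) ?_ v
  refine (sum_sq_hybridClip_le b hcInf hc₂' u j).trans (le_of_eq ?_)
  rw [hc₂, mul_pow, Real.sq_sqrt (hd₀ j)]

theorem isRDP_hybridTwiceSampling (hd₀ : ∀ j, 0 ≤ d₀ j) (hcInf : ∀ j, 0 ≤ cInf j)
    (hc₂ : ∀ j, c₂ j = Real.sqrt (d₀ j) * cInf j) (hq₁ : q₁ ∈ Set.Icc (0 : ℝ) 1)
    (hq₂ : q₂ ∈ Set.Icc (0 : ℝ) 1) {α : ℕ} (hα : 2 ≤ α) {ε : ℝ}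
    (hσ : σ ∈ feasible d₀ cInf q₁ q₂ α ε) :
    IsRDP (hybridTwiceSampling F b c₂ cInf q₁ q₂ σ) α ε := by
  intro X X' hX
  have hp := isProbabilityMeasure_hybridTwiceSampling (σ := σ) (cInf := cInf) (c₂ := c₂) F b hq₁ hq₂
  have hb : ∀ x, _ := fun x => (mixBound_hybridClip_le (σ := σ) b hd₀ hcInf hc₂ hq₁ hq₂ (F x) α).trans
    (binExp_le_exp_of_twiceBound_le hq₁ hα hσ.2)
  rcases hX with ⟨x, rfl⟩ | ⟨x, rfl⟩
  · have := hp X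
    have := hp (x ::ₘ X)
    exact renyiDiv_le (momentBound_hybridTwiceSampling_cons F b hq₁ hq₂ hσ.1 x X).symm hα (hb x)
  · have := hp X'
    exact renyiDiv_le (momentBound_hybridTwiceSampling_cons F b hq₁ hq₂ hσ.1 x X') hα (hb x)

end Bound

open Filter Topology

/-! ### Existence of an optimized noise parameter -/

section Optimum

variable {m : ℕ} {d₀ cInf : Fin m → ℝ} {q₁ q₂ : ℝ}

/-- The privacy bound as a function of the ratios of sensitivity and noise. -/
noncomputable def ratioBound (d₀ : Fin m → ℝ) (q₁ q₂ : ℝ) (α : ℕ) (s : Fin m → ℝ) : ℝ :=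
  Real.log (binExp q₁ (logMoment d₀ q₂ s) α) / ((α : ℝ) - 1)

theorem continuous_ratioBound (d₀ : Fin m → ℝ) (hq₁ : q₁ ∈ Set.Icc (0 : ℝ) 1)
    (hq₂ : q₂ ∈ Set.Icc (0 : ℝ) 1) (α : ℕ) : Continuous (ratioBound d₀ q₁ q₂ α) := by
  refine Continuous.div_const (Continuous.log (continuous_binExp q₁ (fun v => ?_) α)
    fun s => (binExp_pos hq₁ _ α).ne') _
  refine continuous_finsetSum _ fun j _ => continuous_const.mul ?_
  exact ((continuous_coordBound q₂ v).comp (continuous_apply j)).log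
    fun s => (coordBound_pos hq₂ _ v).ne'

theorem ratioBound_zero (d₀ : Fin m → ℝ) (q₁ q₂ : ℝ) (α : ℕ) : ratioBound d₀ q₁ q₂ α 0 = 0 := by
  have : logMoment d₀ q₂ 0 = 0 := by
    ext v
    simp [logMoment, coordBound_zero]
  rw [ratioBound, this, binExp_zero, Real.log_one, zero_div]

/-- As a common noise level tends to infinity, the bound tends to `0 < ε`. -/
theorem nonempty_feasible (d₀ cInf : Fin m → ℝ) (hq₁ : q₁ ∈ Set.Icc (0 : ℝ) 1)
    (hq₂ : q₂ ∈ Set.Icc (0 : ℝ) 1) (α : ℕ) {ε : ℝ} (hε : 0 < ε) :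
    (feasible d₀ cInf q₁ q₂ α ε).Nonempty := by
  have hlim : Tendsto (fun t : ℝ => halfSqRatio cInf (fun _ : Fin m => t)) atTop (𝓝 0) := by
    rw [tendsto_pi_nhds]
    intro j
    exact Tendsto.const_div_atTop ((tendsto_pow_atTop two_ne_zero).const_mul_atTop two_pos) _
  have h := ((continuous_ratioBound d₀ hq₁ hq₂ α).tendsto 0).comp hlim
  rw [ratioBound_zero] at h
  obtain ⟨t, ht, ht0⟩ := ((h.eventually_lt_const hε).and (eventually_gt_atTop 0)).exists
  refine ⟨fun _ => t, fun _ => ht0, ?_⟩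
  rw [twiceBound_epsZero]
  exact ht.le

theorem exists_halfSqRatio_le (hd₀ : ∀ j, 0 < d₀ j)
    (hq₁ : q₁ ∈ Set.Icc (0 : ℝ) 1) (hq₂ : q₂ ∈ Set.Icc (0 : ℝ) 1) (hq₁0 : 0 < q₁) (hq₂0 : 0 < q₂)
    {α : ℕ} (hα : 2 ≤ α) (ε : ℝ) (j : Fin m) :
    ∃ B, 0 < B ∧ ∀ σ ∈ feasible d₀ cInf q₁ q₂ α ε, halfSqRatio cInf σ j ≤ B := by
  have hα2 : (2 : ℝ) ≤ α := by exact_mod_cast hα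
  have hk : (0 : ℝ) < α * (α - 1) := mul_pos (by linarith) (by linarith)
  -- Obtained by keeping only the top term `α` of both binomial averages and only block `j`, then
  -- solving for the ratio. The maximum with `1` only makes `B` positive.
  refine ⟨max 1 ((((((α : ℝ) - 1) * ε - α * Real.log q₁) / d₀ j) - α * Real.log q₂) /
    (α * (α - 1))), lt_max_of_lt_left one_pos, fun σ hσ => le_max_of_le_right ?_⟩
  have h1 := (last_le_binExp hq₁ _ α).trans (binExp_le_exp_of_twiceBound_le hq₁ hα hσ.2)
  have h2 : q₂ ^ α * Real.exp (α * (α - 1) * halfSqRatio cInf σ j) ≤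
      coordBound q₂ (halfSqRatio cInf σ j) α :=
    last_le_binExp hq₂ (fun l => (l : ℝ) * ((l : ℝ) - 1) * halfSqRatio cInf σ j) α
  have hlog : ∀ {q : ℝ}, 0 < q → ∀ x, Real.log (q ^ α * Real.exp x) = α * Real.log q + x :=
    fun hq x => by
      rw [Real.log_mul (pow_pos hq α).ne' (Real.exp_pos x).ne', Real.log_pow, Real.log_exp]
  have h1' := Real.log_le_log (mul_pos (pow_pos hq₁0 α) (Real.exp_pos _)) h1
  have h2' := Real.log_le_log (mul_pos (pow_pos hq₂0 α) (Real.exp_pos _)) h2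
  rw [hlog hq₁0, Real.log_exp] at h1'
  rw [hlog hq₂0] at h2'
  have h3 : d₀ j * Real.log (coordBound q₂ (halfSqRatio cInf σ j) α) ≤
      logMoment d₀ q₂ (halfSqRatio cInf σ) α :=
    Finset.single_le_sum (f := fun j => d₀ j * Real.log (coordBound q₂ (halfSqRatio cInf σ j) α))
      (fun i _ => mul_nonneg (hd₀ i).le
        (Real.log_nonneg (one_le_coordBound hq₂ (halfSqRatio_nonneg cInf σ i) α)))
      (Finset.mem_univ j)
  rw [le_div_iff₀ hk, le_sub_iff_add_le, le_div_iff₀ (hd₀ j)]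
  have h4 := mul_le_mul_of_nonneg_left h2' (hd₀ j).le
  linarith

theorem exists_lower_bound (hd₀ : ∀ j, 0 < d₀ j) (hcInf : ∀ j, 0 < cInf j)
    (hq₁ : q₁ ∈ Set.Icc (0 : ℝ) 1) (hq₂ : q₂ ∈ Set.Icc (0 : ℝ) 1) (hq₁0 : 0 < q₁) (hq₂0 : 0 < q₂)
    {α : ℕ} (hα : 2 ≤ α) (ε : ℝ) :
    ∃ δ : Fin m → ℝ, (∀ j, 0 < δ j) ∧ ∀ σ ∈ feasible d₀ cInf q₁ q₂ α ε, δ ≤ σ := by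
  choose B hB hle using exists_halfSqRatio_le (cInf := cInf) hd₀ hq₁ hq₂ hq₁0 hq₂0 hα ε
  refine ⟨fun j => cInf j / Real.sqrt (2 * B j), fun j => ?_, fun σ hσ j => ?_⟩
  · have := hB j
    exact div_pos (hcInf j) (Real.sqrt_pos.2 (by positivity))
  · have hBj := hB j
    have hσj := hσ.1 j
    have h := hle j σ hσ
    rw [halfSqRatio, div_le_iff₀ (by positivity)] at h
    refine (div_le_iff₀ (Real.sqrt_pos.2 (by positivity))).2 ?_
    refine le_of_sq_le_sq ?_ (by positivity)
    rw [mul_pow, Real.sq_sqrt (by positivity)]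
    linarith

/-- Only points no costlier than a fixed feasible `τ` matter. They lie in a box bounded below by the
constraint and above by the cost, and the constraint is closed there. -/
theorem exists_isOptimalNoise {r : Fin m → ℕ} (hd₀r : ∀ j, d₀ j ≤ r j) (hd₀ : ∀ j, 0 < d₀ j)
    (hcInf : ∀ j, 0 < cInf j) (hq₁ : q₁ ∈ Set.Icc (0 : ℝ) 1) (hq₂ : q₂ ∈ Set.Icc (0 : ℝ) 1)
    (hq₁0 : 0 < q₁) (hq₂0 : 0 < q₂) {α : ℕ} (hα : 2 ≤ α) {ε : ℝ} (hε : 0 < ε) :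
    ∃ σ, IsOptimalNoise r d₀ cInf q₁ q₂ α ε σ := by
  obtain ⟨δ, hδ, hle⟩ := exists_lower_bound (cInf := cInf) hd₀ hcInf hq₁ hq₂ hq₁0 hq₂0 hα ε
  obtain ⟨τ, hτ⟩ := nonempty_feasible d₀ cInf hq₁ hq₂ α hε
  set cost : (Fin m → ℝ) → ℝ := fun σ => ∑ j, (r j : ℝ) * σ j ^ 2 with hcost
  -- Nonempty blocks make the cost control every `σ j`.
  have hr : ∀ j, (1 : ℝ) ≤ r j := fun j => by
    have : (0 : ℝ) < r j := (hd₀ j).trans_le (hd₀r j)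
    exact_mod_cast this
  have hub : ∀ σ, cost σ ≤ cost τ → σ ≤ fun _ => Real.sqrt (cost τ) := fun σ h j => by
    refine Real.le_sqrt_of_sq_le (le_trans ?_ h)
    have h1 := Finset.single_le_sum (f := fun j => (r j : ℝ) * σ j ^ 2)
      (fun i _ => by positivity) (Finset.mem_univ j)
    exact (le_mul_of_one_le_left (sq_nonneg _) (hr j)).trans h1
  set box : Set (Fin m → ℝ) := Set.Icc δ fun _ => Real.sqrt (cost τ) with hbox
  have hpos : ∀ σ ∈ box, ∀ j, 0 < σ j := fun σ hσ j => (hδ j).trans_le (hσ.1 j)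
  -- The lower corner `δ` keeps the box away from `σ j = 0`, where the ratios are singular.
  have hcont : ContinuousOn (fun σ => ratioBound d₀ q₁ q₂ α (halfSqRatio cInf σ)) box := by
    refine (continuous_ratioBound d₀ hq₁ hq₂ α).comp_continuousOn (continuousOn_pi.2 fun j => ?_)
    refine continuousOn_const.div (by fun_prop) fun σ hσ => ?_
    have := hpos σ hσ j
    positivity
  set K : Set (Fin m → ℝ) := box ∩
    (fun σ => ratioBound d₀ q₁ q₂ α (halfSqRatio cInf σ)) ⁻¹' Set.Iic ε with hK
  have hKc : IsCompact K := (isCompact_Icc (a := δ)).of_isClosed_subset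
    (hcont.preimage_isClosed_of_isClosed isClosed_Icc isClosed_Iic) Set.inter_subset_left
  have hmem : ∀ σ ∈ feasible d₀ cInf q₁ q₂ α ε, cost σ ≤ cost τ → σ ∈ K := fun σ hσ h => by
    refine ⟨⟨hle σ hσ, hub σ h⟩, ?_⟩
    have := hσ.2
    rwa [twiceBound_epsZero] at this
  obtain ⟨σ, hσ, hmin⟩ := hKc.exists_isMinOn ⟨τ, hmem τ hτ le_rfl⟩
    (f := cost) (Continuous.continuousOn (by fun_prop))
  refine ⟨σ, ⟨hpos σ hσ.1, ?_⟩, fun ρ hρ => ?_⟩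
  · rw [twiceBound_epsZero]
    exact hσ.2
  · change cost σ ≤ cost ρ
    rcases le_total (cost ρ) (cost τ) with h | h
    · exact hmin (hmem ρ hρ h)
    · exact le_trans (hmin (hmem τ hτ le_rfl)) h

end Optimum

end HybridTwice

theorem theorem7 {𝒳 : Type*} {d m : ℕ} {r : Fin m → ℕ}
    (F : 𝒳 → EuclideanSpace ℝ (Fin d))
    (b : OrthonormalBasis (Σ j : Fin m, Fin (r j)) ℝ (EuclideanSpace ℝ (Fin d)))
    (d₀ c₂ cInf : Fin m → ℝ)
    (hd₀ : ∀ j, 0 ≤ d₀ j) (hd₀r : ∀ j, d₀ j ≤ r j) (hcInf : ∀ j, 0 ≤ cInf j)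
    (hc₂ : ∀ j, c₂ j = Real.sqrt (d₀ j) * cInf j)
    (q₁ q₂ : ℝ) (hq₁ : q₁ ∈ Set.Icc (0 : ℝ) 1) (hq₂ : q₂ ∈ Set.Icc (0 : ℝ) 1)
    (α : ℕ) (hα : 2 ≤ α) (ε : ℝ) :
    -- every noise parameter that satisfies the constraint ensures `(α, ε)`-RDP
    (∀ σ ∈ HybridTwice.feasible d₀ cInf q₁ q₂ α ε,
      HybridTwice.IsRDP (HybridTwice.hybridTwiceSampling F b c₂ cInf q₁ q₂ σ) α ε) ∧
    -- in particular the optimized one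
    (∀ σ, HybridTwice.IsOptimalNoise r d₀ cInf q₁ q₂ α ε σ →
      HybridTwice.IsRDP (HybridTwice.hybridTwiceSampling F b c₂ cInf q₁ q₂ σ) α ε) ∧
    -- which exists, unless a parameter degenerates
    (0 < q₁ → 0 < q₂ → (∀ j, 0 < d₀ j) → (∀ j, 0 < cInf j) → 0 < ε →
      ∃ σ, HybridTwice.IsOptimalNoise r d₀ cInf q₁ q₂ α ε σ) := by
  refine ⟨fun σ hσ => ?_, fun σ hσ => ?_, fun hq₁0 hq₂0 hd₀0 hcInf0 hε => ?_⟩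
  · exact HybridTwice.isRDP_hybridTwiceSampling F b hd₀ hcInf hc₂ hq₁ hq₂ hα hσ
  · exact HybridTwice.isRDP_hybridTwiceSampling F b hd₀ hcInf hc₂ hq₁ hq₂ hα hσ.1
  · exact HybridTwice.exists_isOptimalNoise hd₀r hd₀0 hcInf0 hq₁ hq₂ hq₁0 hq₂0 hα hε
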